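/- **Setting.** Let $(M,d)$ be a complete separable metric space with its Borel $\sigma$-algebra. $B_b(M)$ is the Banach space of bounded Borel functions $M\to\mathbb C$ with the supremum norm, $C_b(M)\subset B_b(M)$ the continuous ones, $\mathcal M(M)$ the space of complex Borel measures, $\langle f,\mu\rangle=\int f\,d\mu$, $\sigma=\sigma(B_b(M),\mathcal M(M))$ the associated weak topology, $\rightharpoonup$ convergence in $\sigma$, and $\mathscr L(B_b(M),\sigma)$ the space of $\sigma$-continuous linear operators on $B_b(M)$ (these are bounded, and are exactly the operators given by bounded complex kernels). For a measure space $(S,m)$, a function $\Phi:S\to B_b(M)$ is $\mathcal M(M)$-integrable if $\langle\Phi,\mu\rangle\in L^1(m)$ for all $\mu\in\mathcal M(M)$ and for each measurable $A\subset S$ there is $x_A\in B_b(M)$ with $\langle x_A,\mu\rangle=\int_A\langle\Phi(s),\mu\rangle\,dm(s)$ for all $\mu$; then $\int_A\Phi\,dm:=x_A$. A *strong Feller semigroup* is a family $\mathscr T=(\mathscr T(t))_{t\ge0}\subset\mathscr L(B_b(M),\sigma)$ with $\mathscr T(0)=I$, $\mathscr T(t+s)=\mathscr T(t)\mathscr T(s)$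 for $s,t\ge 0$, $\mathscr T(t)B_b(M)\subset C_b(M)$ for $t>0$, and $\mathscr T(t)f\rightharpoonup f$ as $t\downarrow0$ for $f\in C_b(M)$. It is of *type* $(C,\omega)$, where $C\ge1$ and $\omega\in\mathbb R$, if $\|\mathscr T(t)\|\le Ce^{\omega t}$ for all $t\ge0$ (such $C,\omega$ always exist). Its *Laplace transform* is $\mathscr R(\lambda)f=\int_0^\infty e^{-\lambda t}\mathscr T(t)f\,dt$ for $\operatorname{Re}\lambda>\omega$ ($\mathcal M(M)$-integral), and its *full generator* is the unique multivalued operator $\mathscr L\subset B_b(M)\times B_b(M)$ with $\mathscr R(\lambda)=(\lambda-\mathscr L)^{-1}$ for $\operatorname{Re}\lambda>\omega$, that is, $(f,g)\in\mathscr L$ if and only if $\mathscr R(\lambda)(\lambda f-g)=f$. Write $D(\mathscr L)=\{f:\exists g,\ (f,g)\in\mathscr L\}$. **Theorem.** Let $\mathscr T$ be a strong Feller semigroup of type $(C,\omega)$ with full generator $\mathscr L$ and Laplace transform $\mathscr R$. Let $B:D(B)\to B_b(M)$ be a linear operator, defined on a linear subspace $D(B)\subset B_b(M)$ with $D(\mathscr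 L)\subset D(B)$, such that 1. $B\mathscr R(\lambda)\in\mathscr L(B_b(M),\sigma)$ for some $\lambda\in\mathbb C$ with $\operatorname{Re}\lambda>\omega$; 2. for every $t>0$ the map $B\mathscr T(t)$, initially defined on $D(\mathscr L)$, has an extension to an operator in $\mathscr L(B_b(M),\sigma)$, still denoted by $B\mathscr T(t)$; 3. for all $f\in B_b(M)$ and $\mu\in\mathcal M(M)$, the function $s\mapsto\langle B\mathscr T(s)f,\mu\rangle$ is measurable on $(0,\infty)$; 4. there is $\varphi\in L^1_{\mathrm{loc}}([0,\infty))$ with $\|B\mathscr T(s)\|\le\varphi(s)$ for all $s>0$. Then $\mathscr L+B=\{(f,g+Bf):(f,g)\in\mathscr L\}$ is the full generator of a strong Feller semigroup $\mathscr P=(\mathscr P(t))_{t\ge0}$ which satisfies, for all $f\in B_b(M)$ and $t\ge0$, $$\mathscr P(t)f=\mathscr T(t)f+\int_0^t\mathscr P(t-s)B\mathscr T(s)f\,ds ,$$ where the integral exists as an $\mathcal M(M)$-integral. -/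

import Mathlib

open MeasureTheory Set Filter Topology
open scoped ENNReal

noncomputable section

namespace StrongFellerPerturbation

/-- The bounded measurable functions `M → ℂ`, as a subspace of the space of all bounded functions
`M → ℂ` with the supremum norm. -/
def bddMeasurable (M : Type*) [MeasurableSpace M] : Submodule ℂ (lp (fun _ : M => ℂ) ∞) where
  carrier := {f | Measurable (fun x => f x)}
  zero_mem' := by simp
  add_mem' := fun hf hg => Measurable.add hf hg
  smul_mem' := fun c _ hf => Measurable.const_smul hf c

/-- The space `B_b(M)` with the supremum norm. -/
def Bb (M : Type*) [MeasurableSpace M] : Type _ := bddMeasurable M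

instance (M : Type*) [MeasurableSpace M] : NormedAddCommGroup (Bb M) :=
  inferInstanceAs (NormedAddCommGroup (bddMeasurable M))

instance (M : Type*) [MeasurableSpace M] : NormedSpace ℂ (Bb M) :=
  inferInstanceAs (NormedSpace ℂ (bddMeasurable M))

instance (M : Type*) [MeasurableSpace M] : CoeFun (Bb M) (fun _ => M → ℂ) where
  coe f := fun x => f.1 x

variable {M : Type*} [MeasurableSpace M]

theorem Bb.norm_le_iff (f : Bb M) {c : ℝ} (hc : 0 ≤ c) : ‖f‖ ≤ c ↔ ∀ x, ‖f x‖ ≤ c :=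
  ⟨fun h x => (lp.norm_apply_le_norm ENNReal.top_ne_zero f.1 x).trans h,
    fun h => lp.norm_le_of_forall_le hc h⟩

theorem Bb.exists_coe_eq (f : M → ℂ) :
    (∃ g : Bb M, ∀ x, g x = f x) ↔ Measurable f ∧ ∃ c, ∀ x, ‖f x‖ ≤ c := by
  constructor
  · rintro ⟨g, hg⟩
    have h : (fun x => g x) = f := funext hg
    subst h
    exact ⟨g.2, ‖g‖, fun x => lp.norm_apply_le_norm ENNReal.top_ne_zero g.1 x⟩
  · rintro ⟨hm, c, hc⟩
    have hb : Memℓp f ∞ := memℓp_infty ⟨c, by rintro _ ⟨x, rfl⟩; exact hc x⟩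
    exact ⟨⟨⟨f, hb⟩, hm⟩, fun x => rfl⟩

@[simp] theorem Bb.add_apply (f g : Bb M) (x : M) : (f + g) x = f x + g x := rfl
@[simp] theorem Bb.sub_apply (f g : Bb M) (x : M) : (f - g) x = f x - g x := rfl
@[simp] theorem Bb.neg_apply (f : Bb M) (x : M) : (-f) x = -f x := rfl
@[simp] theorem Bb.smul_apply (c : ℂ) (f : Bb M) (x : M) : (c • f) x = c * f x := rfl

@[ext] theorem Bb.ext {f g : Bb M} (h : ∀ x, f x = g x) : f = g :=
  Subtype.ext (Subtype.ext (funext h))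

/-- The duality `⟨f, μ⟩ = ∫ f dμ` between `B_b(M)` and the space `𝓜(M)` of complex measures. -/
def dual (f : Bb M) (μ : ComplexMeasure M) : ℂ :=
  VectorMeasure.integral μ (fun x => f x) (ContinuousLinearMap.mul ℝ ℂ)

/-- The weak topology `σ = σ(B_b(M), 𝓜(M))`: the coarsest one making every `⟨·, μ⟩` continuous. -/
abbrev sigma (M : Type*) [MeasurableSpace M] : TopologicalSpace (Bb M) :=
  ⨅ μ : ComplexMeasure M, TopologicalSpace.induced (fun f => dual f μ) inferInstance

/-- `T ∈ 𝓛(B_b(M), σ)`, equivalently `T` is a kernel operator. -/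
def IsSigmaContinuous (T : Bb M →L[ℂ] Bb M) : Prop :=
  @Continuous (Bb M) (Bb M) (sigma M) (sigma M) T

/-- Strong Feller semigroups on `B_b(M)`. Only the values `T t` with `0 ≤ t` are relevant. -/
structure IsStrongFellerSemigroup [TopologicalSpace M] (T : ℝ → (Bb M →L[ℂ] Bb M)) : Prop where
  sigmaContinuous : ∀ t, 0 ≤ t → IsSigmaContinuous (T t)
  map_zero : T 0 = ContinuousLinearMap.id ℂ (Bb M)
  map_add : ∀ s t, 0 ≤ s → 0 ≤ t → T (t + s) = (T t).comp (T s)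
  /-- `T t` maps `B_b(M)` into `C_b(M)` for `t > 0`. -/
  strongFeller : ∀ t, 0 < t → ∀ f : Bb M, Continuous (fun x => T t f x)
  /-- `T t f ⇀ f` as `t ↓ 0`, for `f ∈ C_b(M)`. -/
  tendsto_zero : ∀ f : Bb M, Continuous (fun x => f x) →
    Tendsto (fun t => T t f) (𝓝[>] 0) (@nhds (Bb M) (sigma M) f)

/-- `T` is of type `(C, ω)`. -/
def IsOfType (T : ℝ → (Bb M →L[ℂ] Bb M)) (C ω : ℝ) : Prop :=
  1 ≤ C ∧ ∀ t, 0 ≤ t → ‖T t‖ ≤ C * Real.exp (ω * t)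

/-- `Φ : S → B_b(M)` is `𝓜(M)`-integrable with respect to `m`, and its `𝓜(M)`-integral over the
whole space is `u`. -/
structure HasWeakIntegral {S : Type*} [MeasurableSpace S] (m : Measure S) (Φ : S → Bb M)
    (u : Bb M) : Prop where
  scalarly_integrable : ∀ μ : ComplexMeasure M, Integrable (fun s => dual (Φ s) μ) m
  exists_integral : ∀ A : Set S, MeasurableSet A →
    ∃ v : Bb M, ∀ μ : ComplexMeasure M, dual v μ = ∫ s in A, dual (Φ s) μ ∂m
  integral_eq : ∀ μ : ComplexMeasure M, dual u μ = ∫ s, dual (Φ s) μ ∂m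

/-- `u = 𝓡(z) f`, where `𝓡` is the Laplace transform of `T`: `u` is the `𝓜(M)`-integral of
`t ↦ e^{-zt} T(t) f` over `(0, ∞)`. -/
def IsLaplaceTransform (T : ℝ → (Bb M →L[ℂ] Bb M)) (z : ℂ) (f u : Bb M) : Prop :=
  HasWeakIntegral (volume.restrict (Ioi (0 : ℝ)))
    (fun t : ℝ => Complex.exp (-(z * (t : ℂ))) • T t f) u

/-- The full generator of `T`, as a multivalued operator (a subset of `B_b(M) × B_b(M)`): the
relation `𝓛` with `𝓡(z) = (z - 𝓛)⁻¹` for `Re z > ω`, `(C, ω)` being a type of `T`. Thus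
`(f, g) ∈ 𝓛` means `𝓡(z) (z f - g) = f`. -/
def fullGenerator (T : ℝ → (Bb M →L[ℂ] Bb M)) : Set (Bb M × Bb M) :=
  {p | ∃ C ω : ℝ, IsOfType T C ω ∧
    ∀ z : ℂ, ω < z.re → IsLaplaceTransform T z (z • p.1 - p.2) p.1}

/-- The domain `D(𝓛) = {f | ∃ g, (f, g) ∈ 𝓛}` of a multivalued operator. -/
def domain (L : Set (Bb M × Bb M)) : Set (Bb M) :=
  {f | ∃ g, (f, g) ∈ L}

/-- The sum `𝓛 + B = {(f, g + B f) | (f, g) ∈ 𝓛, f ∈ D(B)}`. -/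
def addOperator (L : Set (Bb M × Bb M)) (B : Bb M →ₗ.[ℂ] Bb M) : Set (Bb M × Bb M) :=
  {p | ∃ g, (p.1, g) ∈ L ∧ ∃ h : p.1 ∈ B.domain, p.2 = g + B ⟨p.1, h⟩}

end StrongFellerPerturbation

end

open StrongFellerPerturbation

noncomputable section

namespace StrongFellerPerturbation

section BoundedFunctions

variable {X : Type*} [MeasurableSpace X]

/-- The evaluation at `x` as a bounded functional. -/
def ev (x : X) : Bb X →L[ℂ] ℂ :=
  LinearMap.mkContinuous
    { toFun := fun f => f.1 x
      map_add' := fun _ _ => rfl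
      map_smul' := fun _ _ => rfl } 1
    (fun f => by
      rw [one_mul]
      exact (Bb.norm_le_iff f (norm_nonneg _)).1 le_rfl x)

theorem norm_ev_le (f : Bb X) (x : X) : ‖ev x f‖ ≤ ‖f‖ :=
  (Bb.norm_le_iff f (norm_nonneg _)).1 le_rfl x

theorem norm_le_iff_ev (f : Bb X) {c : ℝ} (hc : 0 ≤ c) : ‖f‖ ≤ c ↔ ∀ x, ‖ev x f‖ ≤ c :=
  Bb.norm_le_iff f hc

theorem measurable_ev (f : Bb X) : Measurable (fun x => ev x f) := f.2

theorem ext_ev {f g : Bb X} (h : ∀ x, ev x f = ev x g) : f = g := Bb.ext h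

theorem exists_ev_eq {f : X → ℂ} (hm : Measurable f) {c : ℝ} (hc : ∀ x, ‖f x‖ ≤ c) :
    ∃ g : Bb X, ∀ x, ev x g = f x :=
  (Bb.exists_coe_eq f).2 ⟨hm, c, hc⟩

/-- The element of `B_b(X)` given by a bounded measurable function. -/
def Bb.mk (f : X → ℂ) (hm : Measurable f) {c : ℝ} (hc : ∀ x, ‖f x‖ ≤ c) : Bb X :=
  (exists_ev_eq hm hc).choose

@[simp] theorem ev_mk (f : X → ℂ) (hm : Measurable f) {c : ℝ} (hc : ∀ x, ‖f x‖ ≤ c) (x : X) :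
    ev x (Bb.mk f hm hc) = f x :=
  (exists_ev_eq hm hc).choose_spec x

instance : CompleteSpace (Bb X) := by
  have hcl : IsClosed (bddMeasurable X : Set (lp (fun _ : X => ℂ) ∞)) := by
    refine IsSeqClosed.isClosed fun f g hf hg => ?_
    refine measurable_of_tendsto_metrizable (f := fun n x => f n x) (fun n => hf n)
      (tendsto_pi_nhds.2 fun x => ?_)
    have hx : LipschitzWith 1 (fun h : lp (fun _ : X => ℂ) ∞ => h x) := by
      refine LipschitzWith.of_dist_le_mul fun a b => ?_
      rw [dist_eq_norm, dist_eq_norm, NNReal.coe_one, one_mul]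
      exact lp.norm_apply_le_norm ENNReal.top_ne_zero (a - b) x
    exact (hx.continuous.tendsto g).comp hg
  exact (hcl.completeSpace_coe : CompleteSpace (bddMeasurable X))

open Classical in
/-- The indicator function of a set, as an element of `B_b(X)` (zero if it is not measurable). -/
def Bb.ind (A : Set X) : Bb X :=
  if hA : MeasurableSet A then
    Bb.mk (A.indicator 1) (measurable_one.indicator hA) (c := 1) (fun x => by
      by_cases h : x ∈ A <;> simp [h])
  else 0

theorem ev_ind {A : Set X} (hA : MeasurableSet A) (x : X) :
    ev x (Bb.ind A) = A.indicator (1 : X → ℂ) x := by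
  simp [Bb.ind, hA]

/-- Bounded pointwise convergence. -/
def BPTendsto {ι : Type*} (f : ι → Bb X) (l : Filter ι) (g : Bb X) : Prop :=
  (∃ C, ∀ᶠ i in l, ‖f i‖ ≤ C) ∧ ∀ x, Tendsto (fun i => ev x (f i)) l (𝓝 (ev x g))

/-- Sequential continuity of functionals for bounded pointwise convergence. -/
def BPContinuous (ℓ : Bb X → ℂ) : Prop :=
  ∀ (f : ℕ → Bb X) (g : Bb X), BPTendsto f atTop g → Tendsto (fun n => ℓ (f n)) atTop (𝓝 (ℓ g))

theorem BPTendsto.comp {ι κ : Type*} {f : ι → Bb X} {l : Filter ι} {g : Bb X}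
    (h : BPTendsto f l g) {k : Filter κ} {u : κ → ι} (hu : Tendsto u k l) :
    BPTendsto (fun i => f (u i)) k g :=
  ⟨h.1.imp fun _ hC => hu.eventually hC, fun x => (h.2 x).comp hu⟩

theorem BPContinuous.tendsto {ℓ : Bb X → ℂ} (hℓ : BPContinuous ℓ) {ι : Type*} {f : ι → Bb X}
    {l : Filter ι} [l.IsCountablyGenerated] {g : Bb X} (h : BPTendsto f l g) :
    Tendsto (fun i => ℓ (f i)) l (𝓝 (ℓ g)) :=
  tendsto_of_seq_tendsto fun _ hu => hℓ _ _ (h.comp hu)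

theorem bpContinuous_ev (x : X) : BPContinuous (fun f => ev x f) := fun _ _ h => h.2 x

theorem bp_induction_measurableSet {p : Bb X → Prop}
    (ind : ∀ (c : ℂ) (A : Set X), MeasurableSet A → p (c • Bb.ind A))
    (add : ∀ f g, p f → p g → p (f + g))
    (lim : ∀ (f : ℕ → Bb X) g, BPTendsto f atTop g → (∀ n, p (f n)) → p g) (f : Bb X) : p f := by
  have bdd : ∀ s : SimpleFunc X ℂ, ∃ c, ∀ x, ‖s x‖ ≤ c := fun s =>
    (s.finite_range.image norm).bddAbove.imp fun c hc x => hc ⟨_, ⟨x, rfl⟩, rfl⟩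
  have simple : ∀ s : SimpleFunc X ℂ, ∀ g : Bb X, (∀ x, ev x g = s x) → p g := by
    intro s
    induction s using SimpleFunc.induction with
    | @const c A hs =>
      intro g hg
      convert ind c _ hs
      refine ext_ev fun x => ?_
      rw [hg, map_smul, ev_ind hs]
      by_cases h : x ∈ A <;> simp [h]
    | @add s t hd hf hg =>
      intro g hgst
      obtain ⟨c, hc⟩ := bdd s
      obtain ⟨d, hd⟩ := bdd t
      obtain ⟨a, ha⟩ := exists_ev_eq s.measurable hc
      obtain ⟨b, hb⟩ := exists_ev_eq t.measurable hd
      have : g = a + b := ext_ev fun x => by simp [hgst, ha, hb]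
      rw [this]
      exact add _ _ (hf a ha) (hg b hb)
  have hsm := (measurable_ev f).stronglyMeasurable
  have hle := StronglyMeasurable.norm_approxBounded_le hsm (norm_nonneg f)
  choose u hu using fun n => exists_ev_eq (hsm.approxBounded ‖f‖ n).measurable (hle n)
  refine lim u f ⟨⟨‖f‖, Eventually.of_forall fun n => ?_⟩, fun x => ?_⟩ fun n => simple _ _ (hu n)
  · exact (norm_le_iff_ev _ (norm_nonneg _)).2 fun x => (hu n x).symm ▸ hle n x
  · simp only [hu]
    exact StronglyMeasurable.tendsto_approxBounded_of_norm_le hsm (norm_ev_le f x)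

theorem norm_ind_le (A : Set X) : ‖Bb.ind A‖ ≤ 1 := by
  by_cases hA : MeasurableSet A
  · refine (norm_le_iff_ev _ zero_le_one).2 fun x => ?_
    rw [ev_ind hA]
    by_cases h : x ∈ A <;> simp [h]
  · simp [Bb.ind, hA]

theorem bpTendsto_ind_iUnion {A : ℕ → Set X} (hA : ∀ i, MeasurableSet (A i))
    (hd : Pairwise (Function.onFun Disjoint A)) :
    BPTendsto (fun s : Finset ℕ => ∑ i ∈ s, Bb.ind (A i)) atTop (Bb.ind (⋃ i, A i)) := by
  have hfin : ∀ s : Finset ℕ, ∑ i ∈ s, Bb.ind (A i) = Bb.ind (⋃ i ∈ s, A i) := by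
    intro s
    refine ext_ev fun x => ?_
    rw [ev_ind (s.measurableSet_biUnion fun i _ => hA i), map_sum,
      Finset.indicator_biUnion_apply s A fun i _ j _ hij => hd hij]
    exact Finset.sum_congr rfl fun i _ => ev_ind (hA i) x
  simp only [hfin]
  refine ⟨⟨1, Eventually.of_forall fun s => norm_ind_le _⟩, fun x => ?_⟩
  rw [ev_ind (MeasurableSet.iUnion hA)]
  by_cases hx : x ∈ ⋃ i, A i
  · obtain ⟨i, hi⟩ := mem_iUnion.1 hx
    refine tendsto_const_nhds.congr' ?_
    filter_upwards [eventually_ge_atTop {i}] with s hs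
    rw [ev_ind (s.measurableSet_biUnion fun i _ => hA i), indicator_of_mem hx,
      indicator_of_mem (mem_iUnion₂.2 ⟨i, hs (Finset.mem_singleton_self i), hi⟩)]
  · refine tendsto_const_nhds.congr fun s => ?_
    rw [ev_ind (s.measurableSet_biUnion fun i _ => hA i), indicator_of_notMem hx,
      indicator_of_notMem fun h => hx ?_]
    obtain ⟨i, _, hi⟩ := mem_iUnion₂.1 h
    exact mem_iUnion.2 ⟨i, hi⟩

/-- Functional monotone class theorem for bounded pointwise convergence. -/
theorem bp_induction {p : Bb X → Prop} {S : Set (Set X)}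
    (hS : ‹MeasurableSpace X› = MeasurableSpace.generateFrom S) (hpi : IsPiSystem S)
    (univ : ∀ c : ℂ, p (c • Bb.ind univ))
    (basic : ∀ (c : ℂ), ∀ A ∈ S, p (c • Bb.ind A))
    (add : ∀ f g, p f → p g → p (f + g))
    (lim : ∀ (f : ℕ → Bb X) g, BPTendsto f atTop g → (∀ n, p (f n)) → p g) (f : Bb X) : p f := by
  refine bp_induction_measurableSet (fun c A hA => ?_) add lim f
  have zero : p 0 := by simpa using univ 0
  induction A, hA using MeasurableSpace.induction_on_inter hS hpi generalizing c with
  | empty =>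
    convert zero
    exact ext_ev fun x => by simp [ev_ind]
  | basic A hA => exact basic c A hA
  | compl A hA ih =>
    convert add _ _ (univ c) (ih (-c))
    refine ext_ev fun x => ?_
    simp only [map_add, map_smul, ev_ind hA, ev_ind hA.compl, ev_ind MeasurableSet.univ]
    by_cases h : x ∈ A <;> simp [h]
  | iUnion A hd hA ih =>
    have h := (bpTendsto_ind_iUnion hA hd).comp tendsto_finset_range
    refine lim (fun n => c • ∑ i ∈ Finset.range n, Bb.ind (A i)) _ ⟨?_, fun x => ?_⟩ fun n => ?_
    · obtain ⟨C, hC⟩ := h.1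
      exact ⟨‖c‖ * C, hC.mono fun n hn => (norm_smul_le _ _).trans (by gcongr)⟩
    · simpa only [map_smul] using (h.2 x).const_smul c
    · induction n with
      | zero => simpa using zero
      | succ n hn =>
        rw [Finset.sum_range_succ, smul_add]
        exact add _ _ hn (ih n c)

end BoundedFunctions

section Duality

variable {X : Type*} [MeasurableSpace X]

instance isFiniteMeasure_variation (μ : ComplexMeasure X) : IsFiniteMeasure μ.variation := by
  have h : μ.variation ≤ (ComplexMeasure.re μ).totalVariation +
      (ComplexMeasure.im μ).totalVariation := by
    refine VectorMeasure.variation_le_of_forall_enorm_le fun E _ => ?_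
    have h1 : ‖μ E‖ₑ ≤ ‖(μ E).re‖ₑ + ‖(μ E).im‖ₑ := by
      rw [← ofReal_norm, ← ofReal_norm, ← ofReal_norm,
        ← ENNReal.ofReal_add (norm_nonneg _) (norm_nonneg _)]
      exact ENNReal.ofReal_le_ofReal (Complex.norm_le_abs_re_add_abs_im _)
    exact h1.trans (add_le_add (SignedMeasure.enorm_le_totalVariation (ComplexMeasure.re μ) E)
      (SignedMeasure.enorm_le_totalVariation (ComplexMeasure.im μ) E))
  have : IsFiniteMeasure ((ComplexMeasure.re μ).totalVariation +
      (ComplexMeasure.im μ).totalVariation) := by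
    unfold SignedMeasure.totalVariation
    infer_instance
  exact isFiniteMeasure_of_le _ h

theorem dual_eq (f : Bb X) (μ : ComplexMeasure X) :
    dual f μ = VectorMeasure.integral μ (fun x => ev x f) (ContinuousLinearMap.mul ℝ ℂ) := rfl

theorem integrable_ev (f : Bb X) (ν : Measure X) [IsFiniteMeasure ν] :
    Integrable (fun x => ev x f) ν :=
  (integrable_const ‖f‖).mono' (measurable_ev f).aestronglyMeasurable
    (Eventually.of_forall (norm_ev_le f))

theorem dual_add (f g : Bb X) (μ : ComplexMeasure X) : dual (f + g) μ = dual f μ + dual g μ := by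
  simp only [dual_eq, map_add]
  exact VectorMeasure.integral_fun_add (integrable_ev f _) (integrable_ev g _)

theorem bpTendsto_dual {ι : Type*} {f : ι → Bb X} {l : Filter ι} [l.IsCountablyGenerated]
    {g : Bb X} (h : BPTendsto f l g) (μ : ComplexMeasure X) :
    Tendsto (fun i => dual (f i) μ) l (𝓝 (dual g μ)) := by
  simp only [dual_eq]
  refine VectorMeasure.tendsto_integral_filter_of_norm_le_const
    (Eventually.of_forall fun i => (measurable_ev (f i)).aestronglyMeasurable) ?_
    (Eventually.of_forall h.2)
  obtain ⟨C, hC⟩ := h.1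
  exact ⟨C, hC.mono fun i hi => Eventually.of_forall fun x => (norm_ev_le _ x).trans hi⟩

theorem bpContinuous_dual (μ : ComplexMeasure X) : BPContinuous (fun f => dual f μ) :=
  fun _ _ h => bpTendsto_dual h μ

@[simp] theorem dual_dirac (f : Bb X) (x : X) :
    dual f (VectorMeasure.dirac x (1 : ℂ)) = ev x f := by
  rw [dual_eq, VectorMeasure.integral_dirac' (measurable_ev f).stronglyMeasurable]
  simp

theorem dual_smul_ind (c : ℂ) {A : Set X} (hA : MeasurableSet A) (μ : ComplexMeasure X) :
    dual (c • Bb.ind A) μ = c * μ A := by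
  have h : (fun x => ev x (c • Bb.ind A)) = A.indicator (fun _ => c) := by
    ext x
    rw [map_smul, ev_ind hA]
    by_cases h : x ∈ A <;> simp [h]
  rw [dual_eq, h, VectorMeasure.integral_eq_setToFun,
    setToFun_indicator_const _ hA (measure_ne_top _ _)]
  rfl

theorem exists_dual_eq_of_bpContinuous (ℓ : Bb X →ₗ[ℂ] ℂ) (hℓ : BPContinuous ℓ) :
    ∃ μ : ComplexMeasure X, ∀ f, dual f μ = ℓ f := by
  classical
  let μ : ComplexMeasure X :=
    { measureOf' := fun A => ℓ (Bb.ind A)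
      empty' := by
        have : Bb.ind (∅ : Set X) = 0 := ext_ev fun x => by simp [ev_ind]
        rw [this, map_zero]
      not_measurable' := fun A hA => by simp [Bb.ind, hA]
      m_iUnion' := fun A hA hd => by
        have := hℓ.tendsto (bpTendsto_ind_iUnion hA hd)
        simp only [map_sum] at this
        simpa [HasSum] using this }
  refine ⟨μ, fun f => ?_⟩
  induction f using bp_induction_measurableSet with
  | ind c A hA => rw [dual_smul_ind c hA, map_smul]; rfl
  | add f g hf hg => rw [dual_add, map_add, hf, hg]
  | lim f g h hf =>
    exact tendsto_nhds_unique (bpContinuous_dual μ f g h)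
      ((hℓ f g h).congr fun n => (hf n).symm)

/-- Complex measures are complex combinations of four finite measures. -/
theorem exists_dual_eq_sum (μ : ComplexMeasure X) :
    ∃ (c : Fin 4 → ℂ) (ν : Fin 4 → Measure X), (∀ k, IsFiniteMeasure (ν k)) ∧
      ∀ f, dual f μ = ∑ k, c k * ∫ x, ev x f ∂(ν k) := by
  let r := (ComplexMeasure.re μ).toJordanDecomposition
  let i := (ComplexMeasure.im μ).toJordanDecomposition
  have hr : ∀ A, MeasurableSet A → (μ A).re = r.posPart.real A - r.negPart.real A := fun A hA => by
    have h := congrArg (fun s : SignedMeasure X => s A)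
      (ComplexMeasure.re μ).toSignedMeasure_toJordanDecomposition
    exact h.symm.trans (Measure.toSignedMeasure_sub_apply hA)
  have hi : ∀ A, MeasurableSet A → (μ A).im = i.posPart.real A - i.negPart.real A := fun A hA => by
    have h := congrArg (fun s : SignedMeasure X => s A)
      (ComplexMeasure.im μ).toSignedMeasure_toJordanDecomposition
    exact h.symm.trans (Measure.toSignedMeasure_sub_apply hA)
  have hfin : ∀ k, IsFiniteMeasure ((![r.posPart, r.negPart, i.posPart, i.negPart] :
      Fin 4 → Measure X) k) := by
    intro k
    fin_cases k
    · exact r.posPart_finite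
    · exact r.negPart_finite
    · exact i.posPart_finite
    · exact i.negPart_finite
  refine ⟨![1, -1, Complex.I, -Complex.I], ![r.posPart, r.negPart, i.posPart, i.negPart], hfin,
    fun f => ?_⟩
  induction f using bp_induction_measurableSet with
  | ind c A hA =>
    have key : ∀ (ν : Measure X) [IsFiniteMeasure ν],
        ∫ x, ev x (c • Bb.ind A) ∂ν = c * (ν.real A : ℂ) := by
      intro ν _
      simp only [map_smul, ev_ind hA, smul_eq_mul]
      rw [integral_const_mul, Pi.one_def, integral_indicator_const _ hA]
      simp
    rw [dual_smul_ind c hA, ← Complex.re_add_im (μ A), hr A hA, hi A hA]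
    simp only [Fin.sum_univ_four]
    simp only [Matrix.cons_val, key]
    push_cast
    ring
  | add f g hf hg =>
    rw [dual_add, hf, hg, ← Finset.sum_add_distrib]
    refine Finset.sum_congr rfl fun k _ => ?_
    have := hfin k
    simp only [map_add]
    rw [integral_add (integrable_ev f _) (integrable_ev g _), mul_add]
  | lim f g h hf =>
    refine tendsto_nhds_unique (bpContinuous_dual μ f g h)
      (Tendsto.congr (fun n => (hf n).symm) (tendsto_finsetSum _ fun k _ => ?_))
    have := hfin k
    obtain ⟨C, hC⟩ := h.1
    exact (tendsto_integral_filter_of_norm_le_const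
      (Eventually.of_forall fun n => (measurable_ev (f n)).aestronglyMeasurable)
      ⟨C, hC.mono fun n hn => Eventually.of_forall fun x => (norm_ev_le _ x).trans hn⟩
      (Eventually.of_forall h.2)).const_mul _

theorem tendsto_sigma_iff {ι : Type*} {f : ι → Bb X} {l : Filter ι} {g : Bb X} :
    Tendsto f l (@nhds (Bb X) (sigma X) g) ↔
      ∀ μ : ComplexMeasure X, Tendsto (fun i => dual (f i) μ) l (𝓝 (dual g μ)) := by
  rw [nhds_iInf, tendsto_iInf]
  refine forall_congr' fun μ => ?_
  rw [@nhds_induced, tendsto_comap_iff]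
  rfl

/-- A bounded operator given by a kernel: each functional `f ↦ (A f)(x)` is sequentially
continuous for bounded pointwise convergence. -/
def IsKernelOperator (A : Bb X →L[ℂ] Bb X) : Prop :=
  ∀ x, BPContinuous (fun f => ev x (A f))

theorem IsKernelOperator.bpTendsto {A : Bb X →L[ℂ] Bb X} (hA : IsKernelOperator A) {ι : Type*}
    {f : ι → Bb X} {l : Filter ι} [l.IsCountablyGenerated] {g : Bb X} (h : BPTendsto f l g) :
    BPTendsto (fun i => A (f i)) l (A g) := by
  refine ⟨?_, fun x => (hA x).tendsto h⟩
  obtain ⟨C, hC⟩ := h.1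
  exact ⟨‖A‖ * C, hC.mono fun i hi => (A.le_opNorm _).trans (by gcongr)⟩

theorem IsKernelOperator.exists_adjoint {A : Bb X →L[ℂ] Bb X} (hA : IsKernelOperator A)
    (μ : ComplexMeasure X) : ∃ ν : ComplexMeasure X, ∀ f, dual f ν = dual (A f) μ := by
  obtain ⟨c, ν, _, h⟩ := exists_dual_eq_sum μ
  have hlin : ∀ (a : ℂ) (f : Bb X), dual (a • f) μ = a * dual f μ := by
    intro a f
    simp only [h, map_smul, smul_eq_mul, integral_const_mul, Finset.mul_sum]
    exact Finset.sum_congr rfl fun k _ => by ring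
  exact exists_dual_eq_of_bpContinuous
    { toFun := fun f => dual (A f) μ
      map_add' := fun f g => by rw [map_add, dual_add]
      map_smul' := fun a f => by rw [map_smul, hlin]; rfl }
    fun f g hfg => bpTendsto_dual (hA.bpTendsto hfg) μ

theorem isSigmaContinuous_iff {A : Bb X →L[ℂ] Bb X} :
    IsSigmaContinuous A ↔ IsKernelOperator A := by
  constructor
  · intro hA x f g h
    have h1 : Tendsto f atTop (@nhds (Bb X) (sigma X) g) :=
      tendsto_sigma_iff.2 fun μ => bpTendsto_dual h μ
    have h2 := tendsto_sigma_iff.1 (((@Continuous.tendsto _ _ (sigma X) (sigma X) _ hA g)).comp h1)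
      (VectorMeasure.dirac x 1)
    simpa using h2
  · intro hA
    refine continuous_iInf_rng.2 fun μ => ?_
    rw [continuous_induced_rng]
    obtain ⟨ν, hν⟩ := hA.exists_adjoint μ
    have : (fun f => dual f μ) ∘ A = fun f => dual f ν := funext fun f => (hν f).symm
    rw [this]
    exact continuous_iInf_dom (i := ν) continuous_induced_dom

theorem bpTendsto_sigma {ι : Type*} {f : ι → Bb X} {l : Filter ι} [l.IsCountablyGenerated]
    {g : Bb X} (h : BPTendsto f l g) : Tendsto f l (@nhds (Bb X) (sigma X) g) :=
  tendsto_sigma_iff.2 (bpTendsto_dual h)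

theorem tendsto_ev_of_sigma {ι : Type*} {f : ι → Bb X} {l : Filter ι} {g : Bb X}
    (h : Tendsto f l (@nhds (Bb X) (sigma X) g)) (x : X) :
    Tendsto (fun i => ev x (f i)) l (𝓝 (ev x g)) := by
  simpa using tendsto_sigma_iff.1 h (VectorMeasure.dirac x 1)

theorem IsKernelOperator.id : IsKernelOperator (ContinuousLinearMap.id ℂ (Bb X)) :=
  fun x => bpContinuous_ev x

theorem IsKernelOperator.zero : IsKernelOperator (0 : Bb X →L[ℂ] Bb X) := fun x f g _ => by
  simp

theorem IsKernelOperator.comp {A B : Bb X →L[ℂ] Bb X} (hA : IsKernelOperator A)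
    (hB : IsKernelOperator B) : IsKernelOperator (A.comp B) :=
  fun x _ _ h => hA x _ _ (hB.bpTendsto h)

theorem IsKernelOperator.add {A B : Bb X →L[ℂ] Bb X} (hA : IsKernelOperator A)
    (hB : IsKernelOperator B) : IsKernelOperator (A + B) := fun x f g h => by
  simpa using (hA x f g h).add (hB x f g h)

theorem IsKernelOperator.smul {A : Bb X →L[ℂ] Bb X} (hA : IsKernelOperator A) (c : ℂ) :
    IsKernelOperator (c • A) := fun x f g h => by
  simpa using (hA x f g h).const_mul c

theorem IsKernelOperator.of_tendsto {A : ℕ → Bb X →L[ℂ] Bb X} {A' : Bb X →L[ℂ] Bb X}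
    (hA : ∀ n, IsKernelOperator (A n)) (h : Tendsto A atTop (𝓝 A')) : IsKernelOperator A' := by
  intro x f g hfg
  obtain ⟨C, hC⟩ := hfg.1
  have hC' : ∀ᶠ n in atTop, ‖f n‖ ≤ max C ‖g‖ := hC.mono fun n hn => hn.trans (le_max_left _ _)
  have h0 : 0 ≤ max C ‖g‖ := (norm_nonneg g).trans (le_max_right _ _)
  have est : ∀ k (u : Bb X), ‖u‖ ≤ max C ‖g‖ →
      dist (ev x (A' u)) (ev x (A k u)) ≤ ‖A' - A k‖ * max C ‖g‖ := fun k u hu => by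
    rw [dist_eq_norm, ← map_sub]
    exact (norm_ev_le _ _).trans (((A' - A k).le_opNorm u).trans (by gcongr))
  rw [Metric.tendsto_atTop']
  intro ε hε
  have hlim : Tendsto (fun k => ‖A' - A k‖ * max C ‖g‖) atTop (𝓝 0) := by
    simpa using ((tendsto_const_nhds (x := A')).sub h).norm.mul_const (max C ‖g‖)
  obtain ⟨k, hk⟩ := (hlim.eventually (gt_mem_nhds (by positivity : 0 < ε / 3))).exists
  obtain ⟨N, hN⟩ := eventually_atTop.1 (hC'.and
    ((hA k x f g hfg).eventually (Metric.ball_mem_nhds _ (by positivity : 0 < ε / 3))))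
  refine ⟨N, fun n hn => ?_⟩
  obtain ⟨h1, h2⟩ := hN n hn.le
  have e1 := est k (f n) h1
  have e2 := est k g (le_max_right _ _)
  have t1 := dist_triangle (ev x (A' (f n))) (ev x (A k (f n))) (ev x (A' g))
  have t2 := dist_triangle (ev x (A k (f n))) (ev x (A k g)) (ev x (A' g))
  rw [dist_comm (ev x (A k g))] at t2
  change dist (ev x (A' (f n))) (ev x (A' g)) < ε
  change dist (ev x (A k (f n))) (ev x (A k g)) < ε / 3 at h2
  linarith

end Duality

section WeakIntegral

variable {X : Type*} [MeasurableSpace X] {S : Type*} [MeasurableSpace S] {m : Measure S}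

theorem HasWeakIntegral.congr_ae {Φ Ψ : S → Bb X} {u : Bb X} (h : HasWeakIntegral m Φ u)
    (hΦΨ : Φ =ᵐ[m] Ψ) : HasWeakIntegral m Ψ u := by
  have hd : ∀ μ : ComplexMeasure X, (fun s => dual (Φ s) μ) =ᵐ[m] fun s => dual (Ψ s) μ :=
    fun μ => hΦΨ.mono fun s hs => by simp only [hs]
  refine ⟨fun μ => (h.scalarly_integrable μ).congr (hd μ), fun A hA => ?_, fun μ => ?_⟩
  · obtain ⟨v, hv⟩ := h.exists_integral A hA
    exact ⟨v, fun μ => (hv μ).trans (integral_congr_ae (ae_restrict_of_ae (hd μ)))⟩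
  · exact (h.integral_eq μ).trans (integral_congr_ae (hd μ))

theorem HasWeakIntegral.ev_eq {Φ : S → Bb X} {u : Bb X} (h : HasWeakIntegral m Φ u) (x : X) :
    ev x u = ∫ s, ev x (Φ s) ∂m := by
  simpa using h.integral_eq (VectorMeasure.dirac x 1)

/-- `Φ` is jointly measurable and dominated by the integrable function `a`. -/
structure IsDominated (m : Measure S) (a : S → ℝ) (Φ : S → Bb X) : Prop where
  measurable : Measurable (fun p : S × X => ev p.2 (Φ p.1))
  integrable : Integrable a m
  norm_le : ∀ s, ‖Φ s‖ ≤ a s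

variable {a : S → ℝ} {Φ : S → Bb X}

theorem IsDominated.integrable_ev (h : IsDominated m a Φ) (x : X) :
    Integrable (fun s => ev x (Φ s)) m :=
  h.integrable.mono' (h.measurable.comp measurable_prodMk_right).aestronglyMeasurable
    (Eventually.of_forall fun s => (norm_ev_le _ x).trans (h.norm_le s))

theorem IsDominated.restrict (h : IsDominated m a Φ) (A : Set S) :
    IsDominated (m.restrict A) a Φ :=
  ⟨h.measurable, h.integrable.restrict, h.norm_le⟩

theorem IsDominated.exists_ev_eq [SFinite m] (h : IsDominated m a Φ) :
    ∃ u : Bb X, ∀ x, ev x u = ∫ s, ev x (Φ s) ∂m := by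
  refine StrongFellerPerturbation.exists_ev_eq (c := ∫ s, a s ∂m) ?_ fun x => ?_
  · have : StronglyMeasurable (Function.uncurry fun (s : S) (x : X) => ev x (Φ s)) :=
      h.measurable.stronglyMeasurable
    exact (this.integral_prod_left (μ := m)).measurable
  · exact norm_integral_le_of_norm_le h.integrable
      (Eventually.of_forall fun s => (norm_ev_le _ x).trans (h.norm_le s))

theorem IsDominated.integrable_dual [SFinite m] (h : IsDominated m a Φ) (μ : ComplexMeasure X) :
    Integrable (fun s => dual (Φ s) μ) m ∧
      ∀ u : Bb X, (∀ x, ev x u = ∫ s, ev x (Φ s) ∂m) → dual u μ = ∫ s, dual (Φ s) μ ∂m := by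
  obtain ⟨c, ν, hν, hμ⟩ := exists_dual_eq_sum μ
  have hint : ∀ k, Integrable (Function.uncurry fun (s : S) (x : X) => ev x (Φ s))
      (m.prod (ν k)) := fun k => by
    have := hν k
    exact (h.integrable.comp_fst (ν k)).mono' h.measurable.aestronglyMeasurable
      (Eventually.of_forall fun p => (norm_ev_le _ p.2).trans (h.norm_le p.1))
  have hk : ∀ k, Integrable (fun s => c k * ∫ x, ev x (Φ s) ∂ν k) m := fun k => by
    have := hν k
    exact (hint k).integral_prod_left.const_mul _
  simp only [hμ]
  refine ⟨integrable_finsetSum _ fun k _ => hk k, fun u hu => ?_⟩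
  rw [integral_finsetSum _ fun k _ => hk k]
  refine Finset.sum_congr rfl fun k _ => ?_
  have := hν k
  simp only [hu, integral_const_mul]
  rw [integral_integral_swap (hint k)]

theorem IsDominated.hasWeakIntegral [SFinite m] (h : IsDominated m a Φ) {u : Bb X}
    (hu : ∀ x, ev x u = ∫ s, ev x (Φ s) ∂m) : HasWeakIntegral m Φ u := by
  refine ⟨fun μ => (h.integrable_dual μ).1, fun A _ => ?_, fun μ => (h.integrable_dual μ).2 u hu⟩
  obtain ⟨v, hv⟩ := (h.restrict A).exists_ev_eq
  exact ⟨v, fun μ => ((h.restrict A).integrable_dual μ).2 v hv⟩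

/-- Kernel operators commute with integrals. -/
theorem IsKernelOperator.ev_integral [SFinite m] {A : Bb X →L[ℂ] Bb X} (hA : IsKernelOperator A)
    (h : IsDominated m a Φ) {u : Bb X} (hu : ∀ x, ev x u = ∫ s, ev x (Φ s) ∂m) (x : X) :
    ev x (A u) = ∫ s, ev x (A (Φ s)) ∂m := by
  obtain ⟨ν, hν⟩ := hA.exists_adjoint (VectorMeasure.dirac x 1)
  have := (h.hasWeakIntegral hu).integral_eq ν
  simpa [hν] using this

end WeakIntegral

section KernelFamily

variable {X : Type*} [MeasurableSpace X] {S : Type*} [MeasurableSpace S]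

/-- A jointly measurable family of kernel operators. -/
structure IsKernelFamily (A : S → Bb X →L[ℂ] Bb X) : Prop where
  kernel : ∀ s, IsKernelOperator (A s)
  measurable : ∀ f, Measurable (fun p : S × X => ev p.2 (A p.1 f))

variable {Z : Type*} [MeasurableSpace Z]

/-- The section of a bounded measurable function on a product. -/
def sectionAt (g : Bb (Z × X)) (z : Z) : Bb X :=
  Bb.mk (fun x => ev (z, x) g) ((measurable_ev g).comp measurable_prodMk_left)
    (fun x => norm_ev_le g (z, x))

@[simp] theorem ev_sectionAt (g : Bb (Z × X)) (z : Z) (x : X) :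
    ev x (sectionAt g z) = ev (z, x) g := ev_mk _ _ _ x

theorem norm_sectionAt_le (g : Bb (Z × X)) (z : Z) : ‖sectionAt g z‖ ≤ ‖g‖ :=
  (norm_le_iff_ev _ (norm_nonneg _)).2 fun x => by simpa using norm_ev_le g (z, x)

variable {A : S → Bb X →L[ℂ] Bb X}

theorem IsKernelFamily.measurable_sectionAt (hA : IsKernelFamily A) (g : Bb (Z × X)) :
    Measurable (fun q : (S × X) × Z => ev q.1.2 (A q.1.1 (sectionAt g q.2))) := by
  have basic : ∀ (c : ℂ) (s : Set Z) (t : Set X), MeasurableSet s → MeasurableSet t →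
      Measurable (fun q : (S × X) × Z =>
        ev q.1.2 (A q.1.1 (sectionAt (c • Bb.ind (s ×ˢ t)) q.2))) := by
    intro c s t hs ht
    have : ∀ z, sectionAt (c • Bb.ind (s ×ˢ t)) z =
        (s.indicator (1 : Z → ℂ) z) • (c • Bb.ind t : Bb X) := fun z => by
      refine ext_ev fun x => ?_
      simp only [ev_sectionAt, map_smul, ev_ind ht, ev_ind (hs.prod ht)]
      by_cases hz : z ∈ s <;> by_cases hx : x ∈ t <;> simp [hz, hx]
    simp only [this, map_smul (A _) (s.indicator (1 : Z → ℂ) _), map_smul (ev _)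
      (s.indicator (1 : Z → ℂ) _), smul_eq_mul]
    exact ((measurable_one.indicator hs).comp measurable_snd).mul
      ((hA.measurable (c • Bb.ind t)).comp measurable_fst)
  induction g using bp_induction generateFrom_prod.symm isPiSystem_prod with
  | univ c => simpa using basic c univ univ MeasurableSet.univ MeasurableSet.univ
  | basic c B hB =>
    obtain ⟨s, hs, t, ht, rfl⟩ := hB
    exact basic c s t hs ht
  | add f g hf hg =>
    have : ∀ z, sectionAt (f + g) z = sectionAt f z + sectionAt g z := fun z =>
      ext_ev fun x => by simp
    simp only [this, map_add]
    exact hf.add hg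
  | lim f g h hf =>
    refine measurable_of_tendsto_metrizable hf (tendsto_pi_nhds.2 fun q => ?_)
    refine hA.kernel q.1.1 q.1.2 _ _ ⟨?_, fun x => ?_⟩
    · obtain ⟨C, hC⟩ := h.1
      exact ⟨C, hC.mono fun n hn => (norm_sectionAt_le _ _).trans hn⟩
    · simpa using h.2 (q.2, x)

theorem IsKernelFamily.measurable_apply (hA : IsKernelFamily A) {G : Z → Bb X}
    (hG : Measurable (fun p : Z × X => ev p.2 (G p.1))) :
    Measurable (fun q : (S × X) × Z => ev q.1.2 (A q.1.1 (G q.2))) := by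
  let g : ℕ → Bb (Z × X) := fun n =>
    Bb.mk ({p : Z × X | ‖ev p.2 (G p.1)‖ ≤ n}.indicator fun p => ev p.2 (G p.1))
      (hG.indicator (measurableSet_le hG.norm measurable_const)) (c := n) fun p => by
        by_cases hp : ‖ev p.2 (G p.1)‖ ≤ n <;> simp [indicator, hp]
  have hg : ∀ (n : ℕ) z x, ‖ev x (G z)‖ ≤ n → ev x (sectionAt (g n) z) = ev x (G z) := by
    intro n z x h
    simp [g, indicator, h]
  have hg' : ∀ n z x, ‖ev x (sectionAt (g n) z)‖ ≤ ‖ev x (G z)‖ := by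
    intro n z x
    by_cases h : ‖ev x (G z)‖ ≤ n <;> simp [g, indicator, h]
  refine measurable_of_tendsto_metrizable (fun n => hA.measurable_sectionAt (g n))
    (tendsto_pi_nhds.2 fun q => hA.kernel q.1.1 q.1.2 _ _ ⟨⟨‖G q.2‖, ?_⟩, fun x => ?_⟩)
  · exact Eventually.of_forall fun n => (norm_le_iff_ev _ (norm_nonneg _)).2 fun x =>
      (hg' n _ x).trans (norm_ev_le _ x)
  · obtain ⟨N, hN⟩ := exists_nat_ge ‖ev x (G q.2)‖
    refine tendsto_const_nhds.congr' ?_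
    filter_upwards [eventually_ge_atTop N] with n hn
    exact (hg n _ x (hN.trans (by exact_mod_cast hn))).symm

theorem IsKernelFamily.measurable_comp_apply (hA : IsKernelFamily A) {σ : Z → S}
    (hσ : Measurable σ) {G : Z → Bb X} (hG : Measurable (fun p : Z × X => ev p.2 (G p.1))) :
    Measurable (fun p : Z × X => ev p.2 (A (σ p.1) (G p.1))) :=
  (hA.measurable_apply hG).comp
    (((hσ.comp measurable_fst).prodMk measurable_snd).prodMk measurable_fst)

theorem IsKernelFamily.comp (hA : IsKernelFamily A) {B : Z → Bb X →L[ℂ] Bb X}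
    (hB : IsKernelFamily B) {W : Type*} [MeasurableSpace W] {σ : W → S} {τ : W → Z}
    (hσ : Measurable σ) (hτ : Measurable τ) :
    IsKernelFamily (fun w => (A (σ w)).comp (B (τ w))) :=
  ⟨fun _ => (hA.kernel _).comp (hB.kernel _), fun f =>
    hA.measurable_comp_apply hσ (G := fun w => B (τ w) f)
    ((hB.measurable f).comp ((hτ.comp measurable_fst).prodMk measurable_snd))⟩

theorem IsKernelFamily.smul (hA : IsKernelFamily A) {c : S → ℂ} (hc : Measurable c) :
    IsKernelFamily (fun s => c s • A s) :=
  ⟨fun s => (hA.kernel s).smul _, fun f => by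
    change Measurable (fun p : S × X => ev p.2 (c p.1 • A p.1 f))
    simp only [map_smul, smul_eq_mul]
    exact (hc.comp measurable_fst).mul (hA.measurable f)⟩

theorem IsKernelFamily.add (hA : IsKernelFamily A) {B : S → Bb X →L[ℂ] Bb X}
    (hB : IsKernelFamily B) : IsKernelFamily (fun s => A s + B s) :=
  ⟨fun s => (hA.kernel s).add (hB.kernel s), fun f => by
    change Measurable (fun p : S × X => ev p.2 (A p.1 f + B p.1 f))
    simp only [map_add]
    exact (hA.measurable f).add (hB.measurable f)⟩

theorem IsKernelFamily.of_tendsto {A : ℕ → S → Bb X →L[ℂ] Bb X} {A' : S → Bb X →L[ℂ] Bb X}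
    (hA : ∀ n, IsKernelFamily (A n)) (h : ∀ s, Tendsto (fun n => A n s) atTop (𝓝 (A' s))) :
    IsKernelFamily A' := by
  refine ⟨fun s => IsKernelOperator.of_tendsto (fun n => (hA n).kernel s) (h s), fun f => ?_⟩
  refine measurable_of_tendsto_metrizable (fun n => (hA n).measurable f)
    (tendsto_pi_nhds.2 fun p => ?_)
  exact ((ev p.2).continuous.tendsto _).comp
    (((ContinuousLinearMap.apply ℂ (Bb X) f).continuous.tendsto _).comp (h p.1))

theorem IsKernelFamily.isDominated (hA : IsKernelFamily A) {m : Measure S} {a : S → ℝ}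
    (ha : Integrable a m) (hAa : ∀ s, ‖A s‖ ≤ a s) (f : Bb X) :
    IsDominated m (fun s => a s * ‖f‖) (fun s => A s f) :=
  ⟨hA.measurable f, ha.mul_const _, fun s => ((A s).le_opNorm f).trans (by gcongr; exact hAa s)⟩

open Classical in
/-- The operator `f ↦ ∫ A(s) f dm(s)` (zero if it does not exist). -/
def opIntegral (m : Measure S) (A : S → Bb X →L[ℂ] Bb X) : Bb X →L[ℂ] Bb X :=
  if h : ∃ W : Bb X →L[ℂ] Bb X, ∀ f x, ev x (W f) = ∫ s, ev x (A s f) ∂m then h.choose else 0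

variable {m : Measure S} {a : S → ℝ}

theorem IsKernelFamily.ev_opIntegral [SFinite m] (hA : IsKernelFamily A) (ha : Integrable a m)
    (hAa : ∀ s, ‖A s‖ ≤ a s) (f : Bb X) (x : X) :
    ev x (opIntegral m A f) = ∫ s, ev x (A s f) ∂m := by
  have h : ∃ W : Bb X →L[ℂ] Bb X, ∀ f x, ev x (W f) = ∫ s, ev x (A s f) ∂m := by
    choose W hW using fun f => (hA.isDominated ha hAa f).exists_ev_eq
    have hint := fun f x => (hA.isDominated ha hAa f).integrable_ev x
    refine ⟨LinearMap.mkContinuous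
      { toFun := W
        map_add' := fun f g => ext_ev fun x => by
          simp only [hW, map_add]
          exact integral_add (hint f x) (hint g x)
        map_smul' := fun c f => ext_ev fun x => by
          simp only [hW, map_smul, RingHom.id_apply]
          exact integral_smul _ _ } (∫ s, a s ∂m) fun f => ?_, fun f x => hW f x⟩
    refine (norm_le_iff_ev _ ?_).2 fun x => ?_
    · exact mul_nonneg (integral_nonneg fun s => (norm_nonneg _).trans (hAa s)) (norm_nonneg _)
    · rw [← integral_mul_const]
      exact (congrArg norm (hW f x)).trans_le (norm_integral_le_of_norm_le (ha.mul_const _)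
        (Eventually.of_forall fun s => (norm_ev_le _ x).trans
          ((hA.isDominated ha hAa f).norm_le s)))
  rw [opIntegral, dif_pos h]
  exact h.choose_spec f x

theorem IsKernelFamily.isKernelOperator_opIntegral [SFinite m] (hA : IsKernelFamily A)
    (ha : Integrable a m) (hAa : ∀ s, ‖A s‖ ≤ a s) : IsKernelOperator (opIntegral m A) := by
  intro x f g h
  simp only [hA.ev_opIntegral ha hAa]
  obtain ⟨C, hC⟩ := h.1
  refine tendsto_integral_filter_of_dominated_convergence (fun s => a s * C)
    (Eventually.of_forall fun n =>
      ((hA.isDominated ha hAa (f n)).integrable_ev x).aestronglyMeasurable) ?_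
    (ha.mul_const C) (Eventually.of_forall fun s => hA.kernel s x f g h)
  filter_upwards [hC] with n hn
  refine Eventually.of_forall fun s => (norm_ev_le _ x).trans (((A s).le_opNorm _).trans ?_)
  exact mul_le_mul (hAa s) hn (norm_nonneg _) ((norm_nonneg _).trans (hAa s))

theorem norm_le_integral_of_ev_eq {W : Bb X →L[ℂ] Bb X}
    (hW : ∀ f x, ev x (W f) = ∫ s, ev x (A s f) ∂m) (ha : Integrable a m)
    (hAa : ∀ s, ‖A s‖ ≤ a s) : ‖W‖ ≤ ∫ s, a s ∂m := by
  have h0 : 0 ≤ ∫ s, a s ∂m := integral_nonneg fun s => (norm_nonneg _).trans (hAa s)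
  refine W.opNorm_le_bound h0 fun f => (norm_le_iff_ev _ (by positivity)).2 fun x => ?_
  rw [hW, ← integral_mul_const]
  exact norm_integral_le_of_norm_le (ha.mul_const _) (Eventually.of_forall fun s =>
    (norm_ev_le _ x).trans (((A s).le_opNorm f).trans (by gcongr; exact hAa s)))

end KernelFamily

variable {X : Type*} [MeasurableSpace X]

section Laplace

/-- The Laplace transform of `U` at `z` converges absolutely. -/
structure IsLaplaceIntegrable (U : ℝ → Bb X →L[ℂ] Bb X) (z : ℂ) : Prop where
  family : IsKernelFamily U
  exists_bound : ∃ a : ℝ → ℝ, Integrable a ∧ ∀ s : ℝ, ‖Complex.exp (-(z * s)) • U s‖ ≤ a s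

/-- The Laplace transform of a family of operators. -/
def laplace (U : ℝ → Bb X →L[ℂ] Bb X) (z : ℂ) : Bb X →L[ℂ] Bb X :=
  opIntegral volume (fun s : ℝ => Complex.exp (-(z * s)) • U s)

variable {U S : ℝ → Bb X →L[ℂ] Bb X} {z : ℂ}

theorem IsLaplaceIntegrable.smul_family (h : IsLaplaceIntegrable U z) :
    IsKernelFamily (fun s : ℝ => Complex.exp (-(z * s)) • U s) :=
  h.family.smul (by fun_prop)

theorem IsLaplaceIntegrable.exists_isDominated (h : IsLaplaceIntegrable U z) (f : Bb X) :
    ∃ a : ℝ → ℝ, IsDominated volume a (fun s : ℝ => Complex.exp (-(z * s)) • U s f) := by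
  obtain ⟨a, ha, hU⟩ := h.exists_bound
  exact ⟨_, h.smul_family.isDominated ha hU f⟩

theorem IsLaplaceIntegrable.ev_laplace' (h : IsLaplaceIntegrable U z) (f : Bb X) (x : X) :
    ev x (laplace U z f) = ∫ s : ℝ, ev x (Complex.exp (-(z * s)) • U s f) := by
  obtain ⟨a, ha, hU⟩ := h.exists_bound
  exact h.smul_family.ev_opIntegral ha hU f x

theorem IsLaplaceIntegrable.ev_laplace (h : IsLaplaceIntegrable U z) (f : Bb X) (x : X) :
    ev x (laplace U z f) = ∫ s : ℝ, Complex.exp (-(z * s)) * ev x (U s f) := by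
  simpa using h.ev_laplace' f x

theorem IsLaplaceIntegrable.isKernelOperator (h : IsLaplaceIntegrable U z) :
    IsKernelOperator (laplace U z) := by
  obtain ⟨a, ha, hU⟩ := h.exists_bound
  exact h.smul_family.isKernelOperator_opIntegral ha hU

theorem IsLaplaceIntegrable.ev_comp_laplace (h : IsLaplaceIntegrable U z) {A : Bb X →L[ℂ] Bb X}
    (hA : IsKernelOperator A) (f : Bb X) (x : X) :
    ev x (A (laplace U z f)) = ∫ s : ℝ, Complex.exp (-(z * s)) * ev x (A (U s f)) := by
  obtain ⟨a, ha⟩ := h.exists_isDominated f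
  simpa using hA.ev_integral ha (h.ev_laplace' f) x

/-- The Laplace transform turns convolutions into products. -/
theorem IsLaplaceIntegrable.ev_laplace_laplace (hU : IsLaplaceIntegrable U z)
    (hS : IsLaplaceIntegrable S z) (f : Bb X) (x : X) :
    ev x (laplace U z (laplace S z f)) =
      ∫ t : ℝ, Complex.exp (-(z * t)) * ∫ s : ℝ, ev x (U (t - s) (S s f)) := by
  let F : ℝ → ℝ → ℂ := fun t s => Complex.exp (-(z * t)) * ev x (U (t - s) (S s f))
  have hF : ∀ t s : ℝ, F t s = ev x ((Complex.exp (-(z * (t - s : ℝ))) • U (t - s))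
      ((Complex.exp (-(z * s)) • S s) f)) := by
    intro t s
    simp only [F, _root_.smul_apply, map_smul, smul_eq_mul]
    rw [← mul_assoc, ← Complex.exp_add]
    congr 2
    push_cast
    ring
  have hint : Integrable (Function.uncurry F) (volume.prod volume) := by
    obtain ⟨a, ha, hUa⟩ := hU.exists_bound
    obtain ⟨b, hb, hSb⟩ := hS.exists_bound
    have hab := (Integrable.convolution_integrand (ContinuousLinearMap.mul ℝ ℝ) hb ha).mul_const ‖f‖
    refine hab.mono' ?_ (Eventually.of_forall fun p => ?_)
    · have := ((hU.family.comp hS.family (σ := fun p : ℝ × ℝ => p.1 - p.2) (τ := fun p => p.2)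
        (by fun_prop) (by fun_prop)).measurable f).comp (measurable_prodMk_right (y := x))
      exact (Measurable.mul (by fun_prop) this).aestronglyMeasurable
    · rw [Function.uncurry, hF]
      refine (norm_ev_le _ x).trans (((_ : Bb X →L[ℂ] Bb X).le_opNorm _).trans ?_)
      rw [ContinuousLinearMap.mul_apply', mul_comm (b p.2), mul_assoc]
      refine mul_le_mul (hUa _) ?_ (norm_nonneg _) ((norm_nonneg _).trans (hUa _))
      exact ((_ : Bb X →L[ℂ] Bb X).le_opNorm _).trans (by gcongr; exact hSb _)
  calc ev x (laplace U z (laplace S z f))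
      = ∫ s : ℝ, ∫ t : ℝ, F t s := by
        rw [hS.ev_comp_laplace hU.isKernelOperator]
        refine integral_congr_ae (Eventually.of_forall fun s => ?_)
        change Complex.exp (-(z * s)) * ev x (laplace U z (S s f)) = ∫ t : ℝ, F t s
        have : ∀ t : ℝ, F t s = Complex.exp (-(z * s)) *
            (fun r : ℝ => Complex.exp (-(z * r)) * ev x (U r (S s f))) (t - s) := fun t => by
          simp only [F]
          rw [← mul_assoc, ← Complex.exp_add]
          congr 2
          push_cast
          ring
        simp only [this, integral_const_mul]
        rw [integral_sub_right_eq_self (μ := volume)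
          (fun r : ℝ => Complex.exp (-(z * r)) * ev x (U r (S s f))) s, hU.ev_laplace]
    _ = ∫ t : ℝ, ∫ s : ℝ, F t s := (integral_integral_swap hint).symm
    _ = _ := by simp only [F, integral_const_mul]

theorem integrable_indicator_exp {c b : ℝ} (hb : 0 < b) :
    Integrable ((Ioi (0 : ℝ)).indicator fun s => c * Real.exp (-b * s)) :=
  (integrable_indicator_iff measurableSet_Ioi).2 ((exp_neg_integrableOn_Ioi 0 hb).const_mul c)

end Laplace

section Convolution

/-- An exponentially bounded kernel family vanishing on `(-∞, 0]`. -/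
structure IsExpBounded (U : ℝ → Bb X →L[ℂ] Bb X) (c ω : ℝ) : Prop where
  family : IsKernelFamily U
  eq_zero : ∀ t ≤ 0, U t = 0
  norm_le : ∀ t, ‖U t‖ ≤ c * Real.exp (ω * t)

/-- A kernel family vanishing on `(-∞, 0]` whose norm is dominated by `ψ`, where
`s ↦ e^{-ωs} ψ(s)` is integrable. -/
structure IsWeightIntegrable (S : ℝ → Bb X →L[ℂ] Bb X) (ψ : ℝ → ℝ) (ω : ℝ) : Prop where
  family : IsKernelFamily S
  eq_zero : ∀ s ≤ 0, S s = 0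
  norm_le : ∀ s, ‖S s‖ ≤ ψ s
  integrable : Integrable (fun s => Real.exp (-(ω * s)) * ψ s)

/-- The convolution `(U * S)(t) = ∫ U(t - s) S(s) ds`. -/
def conv (U S : ℝ → Bb X →L[ℂ] Bb X) (t : ℝ) : Bb X →L[ℂ] Bb X :=
  opIntegral volume (fun s => (U (t - s)).comp (S s))

variable {U V S : ℝ → Bb X →L[ℂ] Bb X} {c d ω : ℝ} {ψ : ℝ → ℝ}

theorem IsExpBounded.nonneg (h : IsExpBounded U c ω) : 0 ≤ c := by
  simpa using (norm_nonneg _).trans (h.norm_le 0)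

theorem IsExpBounded.add (hU : IsExpBounded U c ω) (hV : IsExpBounded V d ω) :
    IsExpBounded (fun t => U t + V t) (c + d) ω :=
  ⟨hU.family.add hV.family, fun t ht => by simp [hU.eq_zero t ht, hV.eq_zero t ht], fun t =>
    (norm_add_le _ _).trans ((add_le_add (hU.norm_le t) (hV.norm_le t)).trans_eq
      (add_mul _ _ _).symm)⟩

theorem IsExpBounded.mono (hU : IsExpBounded U c ω) {c' ω' : ℝ} (hc : c ≤ c') (hω : ω ≤ ω') :
    IsExpBounded U c' ω' := by
  refine ⟨hU.family, hU.eq_zero, fun t => ?_⟩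
  have := hU.nonneg
  have := hU.nonneg.trans hc
  rcases le_or_gt t 0 with ht | ht
  · rw [hU.eq_zero t ht, norm_zero]
    positivity
  · exact (hU.norm_le t).trans (by gcongr)

theorem IsExpBounded.isLaplaceIntegrable (hU : IsExpBounded U c ω) {z : ℂ} (hz : ω < z.re) :
    IsLaplaceIntegrable U z := by
  refine ⟨hU.family, _, integrable_indicator_exp (c := c) (sub_pos.2 hz), fun s => ?_⟩
  rcases le_or_gt s 0 with hs | hs
  · simp [hU.eq_zero s hs, hs]
  · rw [indicator_of_mem (mem_Ioi.2 hs), norm_smul, Complex.norm_exp]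
    refine (mul_le_mul_of_nonneg_left (hU.norm_le s) (Real.exp_nonneg _)).trans_eq ?_
    rw [mul_left_comm, ← Real.exp_add]
    congr 2
    simp
    ring

theorem IsWeightIntegrable.isLaplaceIntegrable (hS : IsWeightIntegrable S ψ ω) {z : ℂ}
    (hz : ω ≤ z.re) : IsLaplaceIntegrable S z := by
  refine ⟨hS.family, _, hS.integrable, fun s => ?_⟩
  have hψ := (norm_nonneg _).trans (hS.norm_le s)
  rcases le_or_gt s 0 with hs | hs
  · rw [hS.eq_zero s hs, smul_zero, norm_zero]
    positivity
  · rw [norm_smul, Complex.norm_exp]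
    refine mul_le_mul (Real.exp_le_exp.2 ?_) (hS.norm_le s) (norm_nonneg _) (Real.exp_nonneg _)
    simp only [Complex.neg_re, Complex.mul_re, Complex.ofReal_re, Complex.ofReal_im, mul_zero,
      sub_zero]
    nlinarith

theorem IsWeightIntegrable.norm_laplace_le (hS : IsWeightIntegrable S ψ ω) {z : ℂ}
    (hz : ω ≤ z.re) : ‖laplace S z‖ ≤ ∫ s, Real.exp (-(ω * s)) * ψ s := by
  refine norm_le_integral_of_ev_eq (A := fun s : ℝ => Complex.exp (-(z * s)) • S s)
    ((hS.isLaplaceIntegrable hz).ev_laplace') hS.integrable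
    fun s => ?_
  have hψ := (norm_nonneg _).trans (hS.norm_le s)
  rcases le_or_gt s 0 with hs | hs
  · rw [hS.eq_zero s hs, smul_zero, norm_zero]
    positivity
  · rw [norm_smul, Complex.norm_exp]
    refine mul_le_mul (Real.exp_le_exp.2 ?_) (hS.norm_le s) (norm_nonneg _) (Real.exp_nonneg _)
    simp only [Complex.neg_re, Complex.mul_re, Complex.ofReal_re, Complex.ofReal_im, mul_zero,
      sub_zero]
    nlinarith

theorem IsWeightIntegrable.norm_comp_le (hS : IsWeightIntegrable S ψ ω)
    (hU : ∀ t, ‖U t‖ ≤ c * Real.exp (ω * t)) (t s : ℝ) :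
    ‖(U (t - s)).comp (S s)‖ ≤ c * Real.exp (ω * t) * (Real.exp (-(ω * s)) * ψ s) := by
  refine (ContinuousLinearMap.opNorm_comp_le _ _).trans ((mul_le_mul (hU _) (hS.norm_le s)
    (norm_nonneg _) ((norm_nonneg _).trans (hU _))).trans_eq ?_)
  rw [mul_sub, sub_eq_add_neg, Real.exp_add]
  ring

theorem IsWeightIntegrable.integrable_const_mul (hS : IsWeightIntegrable S ψ ω) (c t : ℝ) :
    Integrable (fun s => c * Real.exp (ω * t) * (Real.exp (-(ω * s)) * ψ s)) :=
  hS.integrable.const_mul _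

theorem IsKernelFamily.conv_integrand (hU : IsKernelFamily U) (hS : IsKernelFamily S) (t : ℝ) :
    IsKernelFamily (fun s => (U (t - s)).comp (S s)) :=
  hU.comp hS (by fun_prop) measurable_id

theorem IsExpBounded.isDominated (hU : IsExpBounded U c ω) (hS : IsWeightIntegrable S ψ ω)
    (t : ℝ) (f : Bb X) :
    IsDominated volume (fun s => c * Real.exp (ω * t) * (Real.exp (-(ω * s)) * ψ s) * ‖f‖)
      (fun s => U (t - s) (S s f)) :=
  (hU.family.conv_integrand hS.family t).isDominated (hS.integrable_const_mul c t)
    (hS.norm_comp_le hU.norm_le t) f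

theorem IsExpBounded.ev_conv (hU : IsExpBounded U c ω) (hS : IsWeightIntegrable S ψ ω) (t : ℝ)
    (f : Bb X) (x : X) : ev x (conv U S t f) = ∫ s, ev x (U (t - s) (S s f)) :=
  (hU.family.conv_integrand hS.family t).ev_opIntegral (hS.integrable_const_mul c t)
    (hS.norm_comp_le hU.norm_le t) f x

theorem IsWeightIntegrable.norm_le_of_ev_eq (hS : IsWeightIntegrable S ψ ω) {t : ℝ}
    (hU : ∀ t, ‖U t‖ ≤ c * Real.exp (ω * t)) {W : Bb X →L[ℂ] Bb X}
    (hW : ∀ f x, ev x (W f) = ∫ s, ev x (U (t - s) (S s f))) :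
    ‖W‖ ≤ c * (∫ s, Real.exp (-(ω * s)) * ψ s) * Real.exp (ω * t) := by
  refine (norm_le_integral_of_ev_eq (A := fun s => (U (t - s)).comp (S s)) hW
    (hS.integrable_const_mul c t) (hS.norm_comp_le hU t)).trans_eq ?_
  rw [integral_const_mul]
  ring

theorem IsExpBounded.conv (hU : IsExpBounded U c ω) (hS : IsWeightIntegrable S ψ ω) :
    IsExpBounded (conv U S) (c * ∫ s, Real.exp (-(ω * s)) * ψ s) ω := by
  refine ⟨⟨fun t => ?_, fun f => ?_⟩, fun t ht => ?_, fun t => ?_⟩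
  · exact (hU.family.conv_integrand hS.family t).isKernelOperator_opIntegral
      (hS.integrable_const_mul c t) (hS.norm_comp_le hU.norm_le t)
  · simp only [hU.ev_conv hS]
    have h := ((hU.family.comp hS.family (σ := fun p : ℝ × ℝ => p.1 - p.2) (τ := fun p => p.2)
      (by fun_prop) (by fun_prop)).measurable f).comp
      (show Measurable fun q : (ℝ × X) × ℝ => ((q.1.1, q.2), q.1.2) by fun_prop)
    exact (StronglyMeasurable.integral_prod_right' (ν := volume) h.stronglyMeasurable).measurable
  · refine ContinuousLinearMap.ext fun f => ext_ev fun x => ?_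
    rw [hU.ev_conv hS, _root_.zero_apply, map_zero]
    refine integral_eq_zero_of_ae (Eventually.of_forall fun s => ?_)
    rcases le_or_gt s 0 with hs | hs
    · simp [hS.eq_zero s hs]
    · simp [hU.eq_zero (t - s) (by linarith)]
  · exact hS.norm_le_of_ev_eq hU.norm_le (hU.ev_conv hS t)

/-- Uniqueness for the Volterra equation `D = D * S`. -/
theorem IsWeightIntegrable.eq_zero_of_eq_conv (hS : IsWeightIntegrable S ψ ω)
    (hq : ∫ s, Real.exp (-(ω * s)) * ψ s < 1) {D : ℝ → Bb X →L[ℂ] Bb X}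
    (hD : ∀ t, ‖D t‖ ≤ c * Real.exp (ω * t))
    (h : ∀ t f x, ev x (D t f) = ∫ s, ev x (D (t - s) (S s f))) (t : ℝ) : D t = 0 := by
  set q := ∫ s, Real.exp (-(ω * s)) * ψ s with hq_def
  have hq0 : 0 ≤ q := integral_nonneg fun s =>
    mul_nonneg (Real.exp_nonneg _) ((norm_nonneg _).trans (hS.norm_le s))
  have hn : ∀ n : ℕ, ∀ t, ‖D t‖ ≤ c * q ^ n * Real.exp (ω * t) := by
    intro n
    induction n with
    | zero => simpa using hD
    | succ n ih =>
      intro t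
      refine (hS.norm_le_of_ev_eq ih (h t)).trans_eq ?_
      rw [← hq_def]
      ring
  have hlim : Tendsto (fun n : ℕ => c * q ^ n * Real.exp (ω * t)) atTop (𝓝 0) := by
    simpa using ((tendsto_pow_atTop_nhds_zero_of_lt_one hq0 hq).const_mul c).mul_const
      (Real.exp (ω * t))
  exact norm_le_zero_iff.1 (ge_of_tendsto' hlim fun n => hn n t)

end Convolution

end StrongFellerPerturbation

namespace StrongFellerPerturbation

variable {X : Type*} [MeasurableSpace X]

section Volterra

variable {T S : ℝ → Bb X →L[ℂ] Bb X} {c ω : ℝ} {ψ : ℝ → ℝ}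

/-- The Picard iterates of the Volterra equation `P = T + P * S`. -/
def picard (T S : ℝ → Bb X →L[ℂ] Bb X) : ℕ → ℝ → Bb X →L[ℂ] Bb X
  | 0 => T
  | n + 1 => fun t => T t + conv (picard T S n) S t

variable (hT : IsExpBounded T c ω) (hS : IsWeightIntegrable S ψ ω)
  (hq : ∫ s, Real.exp (-(ω * s)) * ψ s < 1)

include hS in
theorem IsWeightIntegrable.integral_nonneg : 0 ≤ ∫ s, Real.exp (-(ω * s)) * ψ s :=
  MeasureTheory.integral_nonneg fun s =>
    mul_nonneg (Real.exp_nonneg _) ((norm_nonneg _).trans (hS.norm_le s))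

include hT hS hq in
theorem IsExpBounded.picard (n : ℕ) :
    IsExpBounded (picard T S n) (c / (1 - ∫ s, Real.exp (-(ω * s)) * ψ s)) ω := by
  have hq0 := hS.integral_nonneg
  have hc := hT.nonneg
  set q := ∫ s, Real.exp (-(ω * s)) * ψ s with hq_def
  have hq1 : 0 < 1 - q := sub_pos.2 hq
  induction n with
  | zero => exact hT.mono (by rw [le_div_iff₀ hq1]; nlinarith) le_rfl
  | succ n ih =>
    refine (hT.add (ih.conv hS)).mono (le_of_eq ?_) le_rfl
    rw [← hq_def]
    field_simp
    ring

include hT hS hq in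
theorem IsExpBounded.norm_picard_succ_sub_le (n : ℕ) (t : ℝ) :
    ‖StrongFellerPerturbation.picard T S (n + 1) t - StrongFellerPerturbation.picard T S n t‖ ≤
      c * (∫ s, Real.exp (-(ω * s)) * ψ s) ^ (n + 1) * Real.exp (ω * t) := by
  set q := ∫ s, Real.exp (-(ω * s)) * ψ s with hq_def
  induction n generalizing t with
  | zero =>
    simpa [StrongFellerPerturbation.picard] using (hT.conv hS).norm_le t
  | succ n ih =>
    have h1 := hT.picard hS hq (n + 1)
    have h2 := hT.picard hS hq n
    refine (hS.norm_le_of_ev_eq ih fun f x => ?_).trans_eq (by rw [← hq_def]; ring)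
    have : StrongFellerPerturbation.picard T S (n + 1 + 1) t -
        StrongFellerPerturbation.picard T S (n + 1) t =
        StrongFellerPerturbation.conv (StrongFellerPerturbation.picard T S (n + 1)) S t -
        StrongFellerPerturbation.conv (StrongFellerPerturbation.picard T S n) S t := by
      change (T t + _) - (T t + _) = _
      abel
    rw [this]
    simp only [_root_.sub_apply, map_sub]
    rw [h1.ev_conv hS, h2.ev_conv hS, integral_sub ((h1.isDominated hS t f).integrable_ev x)
      ((h2.isDominated hS t f).integrable_ev x)]

/-- Continuity of the functions in the range is preserved by convolution. -/
theorem IsExpBounded.continuous_conv [TopologicalSpace X] [FirstCountableTopology X]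
    {U : ℝ → Bb X →L[ℂ] Bb X} (hU : IsExpBounded U c ω) (hS : IsWeightIntegrable S ψ ω)
    (hcont : ∀ t f, Continuous fun x => ev x (U t f)) (t : ℝ) (f : Bb X) :
    Continuous fun x => ev x (StrongFellerPerturbation.conv U S t f) := by
  have h := hU.isDominated hS t f
  simp only [hU.ev_conv hS]
  exact continuous_of_dominated (fun x => (h.integrable_ev x).aestronglyMeasurable)
    (fun x => Eventually.of_forall fun s => (norm_ev_le _ x).trans (h.norm_le s)) h.integrable
    (Eventually.of_forall fun s => hcont _ _)

include hT hS hq in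
/-- Existence for the Volterra equation `P = T + P * S`. -/
theorem IsExpBounded.exists_eq_add_conv [TopologicalSpace X] [FirstCountableTopology X]
    (hcont : ∀ t f, Continuous fun x => ev x (T t f)) :
    ∃ P : ℝ → Bb X →L[ℂ] Bb X,
      IsExpBounded P (c / (1 - ∫ s, Real.exp (-(ω * s)) * ψ s)) ω ∧
      (∀ t, P t = T t + StrongFellerPerturbation.conv P S t) ∧
      ∀ t f, Continuous fun x => ev x (P t f) := by
  have hq0 := hS.integral_nonneg
  have hpic := hT.picard hS hq
  have hstep := hT.norm_picard_succ_sub_le hS hq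
  set q := ∫ s, Real.exp (-(ω * s)) * ψ s with hq_def
  have hdist : ∀ t n, dist (StrongFellerPerturbation.picard T S n t)
      (StrongFellerPerturbation.picard T S (n + 1) t) ≤ c * q * Real.exp (ω * t) * q ^ n :=
    fun t n => by
      rw [dist_comm, dist_eq_norm]
      exact (hstep n t).trans_eq (by ring)
  choose P hP using fun t => cauchySeq_tendsto_of_complete
    (cauchySeq_of_le_geometric q _ hq (hdist t))
  have hexp : IsExpBounded P (c / (1 - q)) ω := by
    refine ⟨IsKernelFamily.of_tendsto (fun n => (hpic n).family) hP, fun t ht => ?_, fun t => ?_⟩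
    · exact tendsto_nhds_unique (hP t)
        (tendsto_const_nhds.congr fun n => ((hpic n).eq_zero t ht).symm)
    · exact le_of_tendsto (hP t).norm (Eventually.of_forall fun n => (hpic n).norm_le t)
  refine ⟨P, hexp, fun t => ?_, fun t f => ?_⟩
  · have hclose : ∀ n t, ‖StrongFellerPerturbation.picard T S n t - P t‖ ≤
        c * q * q ^ n / (1 - q) * Real.exp (ω * t) := fun n t => by
      rw [← dist_eq_norm]
      exact (dist_le_of_le_geometric_of_tendsto q _ hq (hdist t) (hP t) n).trans_eq (by ring)
    have hlim : Tendsto (fun n => StrongFellerPerturbation.picard T S (n + 1) t) atTop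
        (𝓝 (T t + StrongFellerPerturbation.conv P S t)) := by
      rw [tendsto_iff_norm_sub_tendsto_zero]
      refine squeeze_zero (g := fun n => c * q * q ^ n / (1 - q) * q * Real.exp (ω * t))
        (fun n => norm_nonneg _) (fun n => ?_) ?_
      · refine (hS.norm_le_of_ev_eq (U := fun t => StrongFellerPerturbation.picard T S n t - P t)
          (hclose n) fun f x => ?_).trans_eq (by rw [← hq_def])
        have : StrongFellerPerturbation.picard T S (n + 1) t -
            (T t + StrongFellerPerturbation.conv P S t) =
            StrongFellerPerturbation.conv (StrongFellerPerturbation.picard T S n) S t -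
            StrongFellerPerturbation.conv P S t := by
          change (T t + _) - (T t + _) = _
          abel
        rw [this]
        simp only [_root_.sub_apply, map_sub]
        rw [(hpic n).ev_conv hS, hexp.ev_conv hS,
          integral_sub (((hpic n).isDominated hS t f).integrable_ev x)
            ((hexp.isDominated hS t f).integrable_ev x)]
      · have := tendsto_pow_atTop_nhds_zero_of_lt_one hq0 hq
        simpa using ((((this.const_mul (c * q)).div_const (1 - q)).mul_const q).mul_const
          (Real.exp (ω * t)))
    exact tendsto_nhds_unique ((tendsto_add_atTop_iff_nat 1).2 (hP t)) hlim
  · have hpc : ∀ n t f, Continuous fun x => ev x (StrongFellerPerturbation.picard T S n t f) := by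
      intro n
      induction n with
      | zero => exact hcont
      | succ n ih =>
        intro t f
        change Continuous fun x => ev x (T t f + StrongFellerPerturbation.conv _ S t f)
        simp only [map_add]
        exact (hcont t f).add ((hpic n).continuous_conv hS ih t f)
    have hu : TendstoUniformly (fun n x => ev x (StrongFellerPerturbation.picard T S n t f))
        (fun x => ev x (P t f)) atTop := by
      rw [Metric.tendstoUniformly_iff]
      intro ε hε
      have h0 : Tendsto (fun n => StrongFellerPerturbation.picard T S n t f) atTop
          (𝓝 (P t f)) :=
        ((ContinuousLinearMap.apply ℂ (Bb X) f).continuous.tendsto _).comp (hP t)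
      filter_upwards [Metric.tendsto_nhds.1 h0 ε hε] with n hn x
      rw [dist_comm] at hn
      refine lt_of_le_of_lt ?_ hn
      rw [dist_eq_norm, dist_eq_norm, ← map_sub]
      exact norm_ev_le _ x
    exact hu.continuous (Frequently.of_forall fun n => hpc n t f)

include hS hq in
/-- The solution of the Volterra equation inherits the semigroup law. -/
theorem IsWeightIntegrable.semigroup_of_eq_add_conv {P : ℝ → Bb X →L[ℂ] Bb X}
    (hP : IsExpBounded P c ω)
    (hPeq : ∀ t, P t = T t + StrongFellerPerturbation.conv P S t)
    (hTT : ∀ t s, 0 < t → 0 < s → T (t + s) = (T t).comp (T s))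
    (hST : ∀ t s, 0 < t → 0 < s → S (t + s) = (S t).comp (T s)) {t s : ℝ} (ht : 0 < t)
    (hs : 0 < s) : P (t + s) = (P t).comp (P s) := by
  let D : ℝ → Bb X →L[ℂ] Bb X := fun s => if 0 < s then P (t + s) - (P t).comp (P s) else 0
  have hev : ∀ r f x, ∫ u, ev x (P (r - u) (S u f)) = ev x (P r f) - ev x (T r f) := by
    intro r f x
    rw [← hP.ev_conv hS, ← map_sub, hPeq r, _root_.add_apply]
    simp
  suffices h : D s = 0 by
    have : P (t + s) - (P t).comp (P s) = 0 := by simpa [D, hs] using h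
    exact sub_eq_zero.1 this
  have hc := hP.nonneg
  refine hS.eq_zero_of_eq_conv hq (c := (c + c * c) * Real.exp (ω * t)) (fun s => ?_)
    (fun s f x => ?_) s
  · by_cases hs : 0 < s
    · simp only [D, if_pos hs]
      refine (norm_sub_le _ _).trans ((add_le_add (hP.norm_le _)
        ((ContinuousLinearMap.opNorm_comp_le _ _).trans (mul_le_mul (hP.norm_le t) (hP.norm_le s)
          (norm_nonneg _) (by positivity)))).trans_eq ?_)
      rw [mul_add, Real.exp_add]
      ring
    · simp only [D, if_neg hs, norm_zero]
      positivity
  · by_cases hs : 0 < s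
    swap
    · simp only [D, if_neg hs, _root_.zero_apply, map_zero]
      refine (integral_eq_zero_of_ae (Eventually.of_forall fun r => ?_)).symm
      rcases le_or_gt r 0 with hr | hr
      · simp [hS.eq_zero r hr]
      · have : ¬ r < s := by linarith
        simp [this]
    have h1 := (hP.isDominated hS (t + s) f).integrable_ev x
    have h2 : ∫ r in Ici s, ev x (P (t + s - r) (S r f)) =
        ev x (P t (T s f)) - ev x (T t (T s f)) := by
      rw [← hev, ← integral_indicator measurableSet_Ici, ← integral_add_right_eq_self _ s]
      refine integral_congr_ae ?_
      have hne : ∀ᵐ r : ℝ, r ≠ 0 := by simp [ae_iff]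
      filter_upwards [hne] with r hr
      rcases lt_or_gt_of_ne hr with hr | hr
      · rw [indicator_of_notMem (by simpa using hr), hS.eq_zero r hr.le]
        simp
      · rw [indicator_of_mem (by simpa using hr.le), hST r s hr hs]
        congr 2
        ring_nf
    have h3 : ∫ r in Iio s, ev x (P (t + s - r) (S r f)) =
        (ev x (P (t + s) f) - ev x (T (t + s) f)) -
          (ev x (P t (T s f)) - ev x (T t (T s f))) := by
      rw [← hev, ← h2, ← integral_add_compl measurableSet_Iio h1, compl_Iio]
      ring
    have hk := hP.family.kernel t
    have h4 : ∫ r, ev x (P t (P (s - r) (S r f))) = ev x (P t (P s f)) - ev x (P t (T s f)) := by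
      rw [← hk.ev_integral (hP.isDominated hS s f) (hP.ev_conv hS s f), ← map_sub, ← map_sub]
      congr 2
      rw [hPeq s, _root_.add_apply]
      simp
    have h5 : ∀ r, ev x (D (s - r) (S r f)) =
        (Iio s).indicator (fun r => ev x (P (t + s - r) (S r f))) r -
          ev x (P t (P (s - r) (S r f))) := by
      intro r
      by_cases hr : r < s
      · rw [indicator_of_mem (mem_Iio.2 hr)]
        simp [D, hr, add_sub_assoc]
      · rw [indicator_of_notMem (by simpa using hr), hP.eq_zero (s - r) (by linarith)]
        simp [D, hr]
    have h6 : IsDominated volume _ (fun r => P t (P (s - r) (S r f))) :=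
      (((hP.family.comp (hP.family.conv_integrand hS.family s) (σ := fun _ => t)
        measurable_const measurable_id)).isDominated
          ((hS.integrable_const_mul c s).const_mul ‖P t‖)
          (fun r => (ContinuousLinearMap.opNorm_comp_le _ _).trans
            (mul_le_mul_of_nonneg_left (hS.norm_comp_le hP.norm_le s r) (norm_nonneg _))) f)
    simp only [h5]
    rw [integral_sub (h1.indicator measurableSet_Iio) (h6.integrable_ev x),
      integral_indicator measurableSet_Iio, h3, h4]
    simp only [D, if_pos hs, _root_.sub_apply, map_sub, ContinuousLinearMap.comp_apply,
      hTT t s ht hs]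
    ring

end Volterra

end StrongFellerPerturbation

namespace StrongFellerPerturbation

variable {M : Type*} [MeasurableSpace M]

/-- The restriction of a family of operators to `(0, ∞)`, extended by zero. -/
def causal (U : ℝ → Bb M →L[ℂ] Bb M) (t : ℝ) : Bb M →L[ℂ] Bb M :=
  if 0 < t then U t else 0

theorem causal_of_pos (U : ℝ → Bb M →L[ℂ] Bb M) {t : ℝ} (ht : 0 < t) : causal U t = U t :=
  if_pos ht

theorem causal_of_nonpos (U : ℝ → Bb M →L[ℂ] Bb M) {t : ℝ} (ht : t ≤ 0) : causal U t = 0 :=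
  if_neg ht.not_gt

theorem measurable_ev_floor (g : ℤ → Bb M) (c : ℝ) :
    Measurable (fun p : ℝ × M => ev p.2 (g ⌊p.1 * c⌋)) := by
  have h1 : Measurable (fun q : ℤ × M => ev q.2 (g q.1)) :=
    measurable_from_prod_countable_right fun k => measurable_ev (g k)
  have h2 : Measurable (fun p : ℝ × M => ⌊p.1 * c⌋) :=
    Int.measurable_floor.comp (measurable_fst.mul_const c)
  exact h1.comp (h2.prodMk measurable_snd)

/-- Right continuity in time implies joint measurability. -/
theorem IsKernelFamily.of_tendsto_right {U : ℝ → Bb M →L[ℂ] Bb M}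
    (hk : ∀ t, 0 < t → IsKernelOperator (U t))
    (hr : ∀ t, 0 < t → ∀ f x, Tendsto (fun h => ev x (U (h + t) f)) (𝓝[>] 0) (𝓝 (ev x (U t f)))) :
    IsKernelFamily (causal U) := by
  refine ⟨fun t => ?_, fun f => ?_⟩
  · rcases le_or_gt t 0 with ht | ht
    · rw [causal_of_nonpos U ht]
      exact IsKernelOperator.zero
    · rw [causal_of_pos U ht]
      exact hk t ht
  obtain ⟨τ, hτdef⟩ : ∃ τ : ℕ → ℝ → ℝ, ∀ n t, τ n t = ((⌊t * (n + 1)⌋ : ℝ) + 1) / (n + 1) :=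
    ⟨_, fun _ _ => rfl⟩
  have hτ : ∀ n t, 0 < τ n t - t ∧ τ n t - t ≤ 1 / ((n : ℝ) + 1) := fun n t => by
    have hn : (0 : ℝ) < n + 1 := by positivity
    have h1 := Int.lt_floor_add_one (t * (n + 1))
    have h2 := Int.floor_le (t * (n + 1))
    rw [hτdef]
    constructor
    · rw [sub_pos, lt_div_iff₀ hn]
      exact h1
    · rw [tsub_le_iff_right, div_add' _ _ _ hn.ne', div_le_div_iff_of_pos_right hn]
      linarith
  have hτ0 : ∀ t, Tendsto (fun n => τ n t - t) atTop (𝓝[>] 0) := fun t => by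
    refine tendsto_nhdsWithin_iff.2 ⟨?_, Eventually.of_forall fun n => (hτ n t).1⟩
    exact squeeze_zero (fun n => (hτ n t).1.le) (fun n => (hτ n t).2)
      tendsto_one_div_add_atTop_nhds_zero_nat
  let F : ℕ → ℝ × M → ℂ := fun n =>
    {p | 0 < p.1}.indicator fun p => ev p.2 (U (τ n p.1) f)
  have hF : ∀ n, Measurable (F n) := fun n => by
    refine Measurable.indicator ?_ (measurableSet_lt measurable_const measurable_fst)
    simp only [hτdef]
    exact measurable_ev_floor (fun k => U (((k : ℝ) + 1) / (n + 1)) f) (n + 1)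
  refine measurable_of_tendsto_metrizable hF (tendsto_pi_nhds.2 fun p => ?_)
  rcases le_or_gt p.1 0 with hp | hp
  · have : ∀ n, F n p = 0 := fun n => indicator_of_notMem (by simpa using hp) _
    simp [causal_of_nonpos U hp, this]
  · have : ∀ n, F n p = ev p.2 (U (τ n p.1 - p.1 + p.1) f) := fun n => by
      rw [sub_add_cancel]
      exact indicator_of_mem (show p ∈ {p : ℝ × M | 0 < p.1} from hp) _
    simp only [this, causal_of_pos U hp]
    exact (hr p.1 hp f p.2).comp (hτ0 p.1)

section Semigroup

variable [TopologicalSpace M] {T : ℝ → Bb M →L[ℂ] Bb M} {C ω : ℝ} {z w : ℂ}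

theorem IsStrongFellerSemigroup.kernel (hT : IsStrongFellerSemigroup T) {t : ℝ} (ht : 0 ≤ t) :
    IsKernelOperator (T t) :=
  isSigmaContinuous_iff.1 (hT.sigmaContinuous t ht)

theorem IsStrongFellerSemigroup.continuous_ev (hT : IsStrongFellerSemigroup T) {t : ℝ}
    (ht : 0 < t) (f : Bb M) : Continuous fun x => ev x (T t f) :=
  hT.strongFeller t ht f

theorem IsStrongFellerSemigroup.tendsto_ev (hT : IsStrongFellerSemigroup T) {f : Bb M}
    (hf : Continuous fun x => ev x f) (x : M) :
    Tendsto (fun t => ev x (T t f)) (𝓝[>] 0) (𝓝 (ev x f)) :=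
  tendsto_ev_of_sigma (hT.tendsto_zero f hf) x

theorem IsStrongFellerSemigroup.tendsto_ev_right (hT : IsStrongFellerSemigroup T) {t : ℝ}
    (ht : 0 < t) (f : Bb M) (x : M) :
    Tendsto (fun h => ev x (T (h + t) f)) (𝓝[>] 0) (𝓝 (ev x (T t f))) := by
  refine (hT.tendsto_ev (hT.continuous_ev ht f) x).congr' ?_
  filter_upwards [self_mem_nhdsWithin] with h hh
  rw [hT.map_add t h ht.le (le_of_lt hh)]
  rfl

omit [TopologicalSpace M] in
theorem IsOfType.nonneg (h : IsOfType T C ω) : 0 ≤ C := zero_le_one.trans h.1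

omit [TopologicalSpace M] in
theorem IsOfType.bpTendsto (htype : IsOfType T C ω) {f g : Bb M} {ι : Type*} {l : Filter ι}
    {u : ι → ℝ} {b : ℝ} (hu : ∀ᶠ i in l, 0 ≤ u i ∧ u i ≤ b)
    (h : ∀ x, Tendsto (fun i => ev x (T (u i) f)) l (𝓝 (ev x g))) :
    BPTendsto (fun i => T (u i) f) l g := by
  refine ⟨⟨C * Real.exp (|ω| * b) * ‖f‖, ?_⟩, h⟩
  filter_upwards [hu] with i hi
  refine ((T (u i)).le_opNorm f).trans (mul_le_mul_of_nonneg_right ?_ (norm_nonneg _))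
  refine (htype.2 _ hi.1).trans (mul_le_mul_of_nonneg_left (Real.exp_le_exp.2 ?_) htype.nonneg)
  exact mul_le_mul (le_abs_self ω) hi.2 hi.1 (abs_nonneg ω)

theorem IsStrongFellerSemigroup.isExpBounded (hT : IsStrongFellerSemigroup T)
    (htype : IsOfType T C ω) : IsExpBounded (causal T) C ω := by
  refine ⟨IsKernelFamily.of_tendsto_right (fun t ht => hT.kernel ht.le)
    (fun t ht => hT.tendsto_ev_right ht), fun t ht => causal_of_nonpos T ht, fun t => ?_⟩
  rcases le_or_gt t 0 with ht | ht
  · rw [causal_of_nonpos T ht, norm_zero]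
    exact mul_nonneg htype.nonneg (Real.exp_nonneg _)
  · rw [causal_of_pos T ht]
    exact htype.2 t ht.le

theorem IsStrongFellerSemigroup.isLaplaceIntegrable (hT : IsStrongFellerSemigroup T)
    (htype : IsOfType T C ω) (hz : ω < z.re) : IsLaplaceIntegrable (causal T) z :=
  (hT.isExpBounded htype).isLaplaceIntegrable hz

theorem IsStrongFellerSemigroup.isLaplaceTransform_iff (hT : IsStrongFellerSemigroup T)
    (htype : IsOfType T C ω) (hz : ω < z.re) {f u : Bb M} :
    IsLaplaceTransform T z f u ↔ laplace (causal T) z f = u := by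
  have hL := hT.isLaplaceIntegrable htype hz
  have hae : (fun t : ℝ => Complex.exp (-(z * t)) • T t f) =ᵐ[volume.restrict (Ioi 0)]
      fun t : ℝ => Complex.exp (-(z * t)) • causal T t f := by
    filter_upwards [self_mem_ae_restrict measurableSet_Ioi] with t ht
    rw [causal_of_pos T ht]
  have hset : ∀ x, ∫ t : ℝ in Ioi 0, ev x (Complex.exp (-(z * t)) • causal T t f) =
      ev x (laplace (causal T) z f) := fun x => by
    rw [hL.ev_laplace']
    refine setIntegral_eq_integral_of_forall_compl_eq_zero fun t ht => ?_
    simp [causal_of_nonpos T (not_lt.1 ht)]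
  constructor
  · intro h
    refine ext_ev fun x => ?_
    rw [← hset x]
    exact ((h.congr_ae hae).ev_eq x).symm
  · rintro rfl
    obtain ⟨a, ha⟩ := hL.exists_isDominated f
    exact ((ha.restrict _).hasWeakIntegral fun x => (hset x).symm).congr_ae hae.symm

theorem IsStrongFellerSemigroup.causal_comm (hT : IsStrongFellerSemigroup T) {t : ℝ} (ht : 0 ≤ t)
    (s : ℝ) (f : Bb M) : causal T s (T t f) = T t (causal T s f) := by
  rcases le_or_gt s 0 with hs | hs
  · simp [causal_of_nonpos T hs]
  · rw [causal_of_pos T hs]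
    have h1 := hT.map_add s t hs.le ht
    rw [add_comm, hT.map_add t s ht hs.le] at h1
    exact congrArg (fun A : Bb M →L[ℂ] Bb M => A f) h1

theorem IsStrongFellerSemigroup.laplace_comm (hT : IsStrongFellerSemigroup T)
    (htype : IsOfType T C ω) (hz : ω < z.re) {t : ℝ} (ht : 0 ≤ t) (f : Bb M) :
    T t (laplace (causal T) z f) = laplace (causal T) z (T t f) := by
  have hL := hT.isLaplaceIntegrable htype hz
  refine ext_ev fun x => ?_
  rw [hL.ev_comp_laplace (hT.kernel ht), hL.ev_laplace]
  simp only [hT.causal_comm ht]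

/-- The resolvent identity. -/
theorem IsStrongFellerSemigroup.resolvent_identity (hT : IsStrongFellerSemigroup T)
    (htype : IsOfType T C ω) (hz : ω < z.re) (hw : ω < w.re) (f : Bb M) :
    (z - w) • laplace (causal T) z (laplace (causal T) w f) =
      laplace (causal T) w f - laplace (causal T) z f := by
  rcases eq_or_ne z w with rfl | hne
  · simp
  have hzw : z - w ≠ 0 := sub_ne_zero.2 hne
  have hLz := hT.isLaplaceIntegrable htype hz
  have hLw := hT.isLaplaceIntegrable htype hw
  let S : ℝ → Bb M →L[ℂ] Bb M := fun s => Complex.exp ((z - w) * s) • causal T s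
  have hexp : ∀ s : ℝ, Complex.exp (-(z * s)) • S s = Complex.exp (-(w * s)) • causal T s := by
    intro s
    simp only [S, smul_smul]
    rw [← Complex.exp_add]
    congr 2
    ring
  have hS : IsLaplaceIntegrable S z :=
    ⟨hLz.family.smul (by fun_prop), by simpa only [hexp] using hLw.exists_bound⟩
  have hSw : laplace S z = laplace (causal T) w := by
    simp only [laplace, hexp]
  refine ext_ev fun x => ?_
  rw [map_smul, ← hSw, hLz.ev_laplace_laplace hS, hSw, map_sub, hLz.ev_laplace, hLw.ev_laplace]
  have hint : ∀ v : ℂ, ω < v.re →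
      Integrable (fun s : ℝ => Complex.exp (-(v * s)) * ev x (causal T s f)) := fun v hv => by
    obtain ⟨a, ha⟩ := (hT.isLaplaceIntegrable htype hv).exists_isDominated f
    simpa using ha.integrable_ev x
  rw [← integral_sub (hint w hw) (hint z hz), smul_eq_mul, ← integral_const_mul]
  refine integral_congr_ae (Eventually.of_forall fun t => ?_)
  have hconv : ∀ s : ℝ, ev x (causal T (t - s) (S s f)) =
      (Ioo 0 t).indicator (fun s : ℝ => Complex.exp ((z - w) * s) * ev x (causal T t f)) s := by
    intro s
    simp only [S, _root_.smul_apply, map_smul, smul_eq_mul]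
    by_cases hs : s ∈ Ioo 0 t
    · have ht : 0 < t := hs.1.trans hs.2
      rw [indicator_of_mem hs, causal_of_pos T hs.1, causal_of_pos T (sub_pos.2 hs.2),
        causal_of_pos T ht]
      have h1 := hT.map_add s (t - s) hs.1.le (sub_nonneg.2 hs.2.le)
      rw [sub_add_cancel] at h1
      rw [h1]
      rfl
    · rw [indicator_of_notMem hs]
      rcases le_or_gt s 0 with h0 | h0
      · simp [causal_of_nonpos T h0]
      · have : t - s ≤ 0 := by
          by_contra! h
          exact hs ⟨h0, by linarith⟩
        simp [causal_of_nonpos T this]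
  simp only [hconv]
  rw [integral_indicator measurableSet_Ioo, integral_mul_const]
  rcases le_or_gt t 0 with ht | ht
  · simp [causal_of_nonpos T ht]
  · rw [← integral_Ioc_eq_integral_Ioo, ← intervalIntegral.integral_of_le ht.le,
      integral_exp_mul_complex hzw]
    have h1 : Complex.exp (-(w * t)) = Complex.exp (-(z * t)) * Complex.exp ((z - w) * t) := by
      rw [← Complex.exp_add]
      congr 1
      ring
    rw [h1]
    field_simp
    simp
    ring

theorem IsStrongFellerSemigroup.laplace_eq_laplace (hT : IsStrongFellerSemigroup T)
    (htype : IsOfType T C ω) (hz : ω < z.re) (hw : ω < w.re) (f : Bb M) :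
    laplace (causal T) w f = laplace (causal T) z (f + (z - w) • laplace (causal T) w f) := by
  rw [_root_.map_add, map_smul, hT.resolvent_identity htype hz hw]
  abel

theorem IsStrongFellerSemigroup.laplace_comp_comm (hT : IsStrongFellerSemigroup T)
    (htype : IsOfType T C ω) (hz : ω < z.re) (hw : ω < w.re) (f : Bb M) :
    laplace (causal T) z (laplace (causal T) w f) =
      laplace (causal T) w (laplace (causal T) z f) := by
  rcases eq_or_ne z w with rfl | hne
  · rfl
  have h1 := hT.resolvent_identity htype hz hw f
  have h2 := hT.resolvent_identity htype hw hz f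
  refine smul_right_injective _ (sub_ne_zero.2 hne) (h1.trans ?_)
  change _ = (z - w) • _
  rw [← neg_sub w z, neg_smul, h2, neg_sub]

theorem IsStrongFellerSemigroup.laplace_smul_sub (hT : IsStrongFellerSemigroup T)
    (htype : IsOfType T C ω) (hz : ω < z.re) (hw : ω < w.re) {f g : Bb M}
    (h : laplace (causal T) z (z • f - g) = f) : laplace (causal T) w (w • f - g) = f := by
  have h1 := hT.resolvent_identity htype hw hz (z • f - g)
  rw [h] at h1
  have h2 : w • f - g = (z • f - g) + (w - z) • f := by
    rw [sub_smul]
    abel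
  rw [h2, _root_.map_add, map_smul, h1]
  abel

theorem IsStrongFellerSemigroup.mem_fullGenerator_iff (hT : IsStrongFellerSemigroup T)
    (htype : IsOfType T C ω) {f g : Bb M} :
    (f, g) ∈ fullGenerator T ↔
      ∃ z : ℂ, ω < z.re ∧ laplace (causal T) z (z • f - g) = f := by
  constructor
  · rintro ⟨C', ω', htype', h⟩
    obtain ⟨r, hr⟩ := exists_gt (max ω ω')
    have h1 : ω < ((r : ℂ)).re := (le_max_left _ _).trans_lt hr
    exact ⟨r, h1, (hT.isLaplaceTransform_iff htype h1).1
      (h r ((le_max_right _ _).trans_lt hr))⟩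
  · rintro ⟨z, hz, h⟩
    exact ⟨C, ω, htype, fun w hw => (hT.isLaplaceTransform_iff htype hw).2
      (hT.laplace_smul_sub htype hz hw h)⟩

theorem IsStrongFellerSemigroup.laplace_mem_domain (hT : IsStrongFellerSemigroup T)
    (htype : IsOfType T C ω) (hz : ω < z.re) (f : Bb M) :
    laplace (causal T) z f ∈ domain (fullGenerator T) :=
  ⟨z • laplace (causal T) z f - f, (hT.mem_fullGenerator_iff htype).2 ⟨z, hz, by simp⟩⟩

/-- `n R(n) f → f` boundedly and pointwise for continuous `f`. -/
theorem IsStrongFellerSemigroup.bpTendsto_laplace (hT : IsStrongFellerSemigroup T)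
    (htype : IsOfType T C ω) {f : Bb M} (hf : Continuous fun x => ev x f) :
    BPTendsto (fun n : ℕ => ((n : ℂ)) • laplace (causal T) (n : ℂ) f) atTop f := by
  have hC := htype.nonneg
  have hexp := hT.isExpBounded htype
  have hn : ∀ᶠ n : ℕ in atTop, 0 < (n : ℝ) ∧ 2 * |ω| < n := by
    filter_upwards [eventually_gt_atTop 0,
      tendsto_natCast_atTop_atTop.eventually (eventually_gt_atTop (2 * |ω|))] with n h0 h1
    exact ⟨by exact_mod_cast h0, h1⟩
  have hformula : ∀ᶠ n : ℕ in atTop, ∀ x, ev x ((n : ℂ) • laplace (causal T) (n : ℂ) f) =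
      ∫ u : ℝ, Complex.exp (-u) * ev x (causal T (u / n) f) := by
    filter_upwards [hn] with n hn x
    have h1 : ω < ((n : ℂ)).re := by
      have := le_abs_self ω
      have := abs_nonneg ω
      simp only [Complex.natCast_re]
      linarith [hn.2]
    rw [map_smul, (hT.isLaplaceIntegrable htype h1).ev_laplace]
    have h2 := Measure.integral_comp_mul_left
      (fun s : ℝ => Complex.exp (-((n : ℂ) * s)) * ev x (causal T s f)) ((n : ℝ)⁻¹)
    rw [inv_inv, abs_of_pos hn.1] at h2
    rw [smul_eq_mul]
    refine Eq.trans ?_ (h2.symm.trans (integral_congr_ae (Eventually.of_forall fun u => ?_)))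
    · simp
    · have : (n : ℂ) ≠ 0 := by exact_mod_cast hn.1.ne'
      simp only [Complex.ofReal_mul, Complex.ofReal_inv, Complex.ofReal_natCast]
      rw [mul_inv_cancel_left₀ this, div_eq_inv_mul]
  let b : ℝ → ℝ := (Ioi (0 : ℝ)).indicator fun s => C * ‖f‖ * Real.exp (-(1 / 2) * s)
  have hb : Integrable b := integrable_indicator_exp (by norm_num)
  have hbound : ∀ᶠ n : ℕ in atTop, ∀ x (u : ℝ),
      ‖Complex.exp (-u) * ev x (causal T (u / n) f)‖ ≤ b u := by
    filter_upwards [hn] with n hn x u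
    rcases le_or_gt u 0 with hu | hu
    · rw [causal_of_nonpos T (div_nonpos_of_nonpos_of_nonneg hu hn.1.le)]
      simp [b, hu]
    · simp only [b, indicator_of_mem (mem_Ioi.2 hu)]
      rw [norm_mul, ← Complex.ofReal_neg, Complex.norm_exp, Complex.ofReal_re]
      have h1 : ω * (u / n) ≤ 1 / 2 * u := by
        have h2 : ω ≤ n / 2 := by linarith [le_abs_self ω, hn.2]
        calc ω * (u / n) ≤ n / 2 * (u / n) := by gcongr
          _ = 1 / 2 * u := by have := hn.1.ne'; field_simp
      calc Real.exp (-u) * ‖ev x (causal T (u / n) f)‖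
          ≤ Real.exp (-u) * (C * Real.exp (1 / 2 * u) * ‖f‖) := by
            gcongr
            refine (norm_ev_le _ x).trans (((causal T (u / n)).le_opNorm f).trans ?_)
            gcongr
            exact (hexp.norm_le _).trans (by gcongr)
        _ = C * ‖f‖ * (Real.exp (-u) * Real.exp (1 / 2 * u)) := by ring
        _ = C * ‖f‖ * Real.exp (-(1 / 2) * u) := by
            rw [← Real.exp_add]
            congr 2
            ring
  refine ⟨⟨∫ u, b u, ?_⟩, fun x => ?_⟩
  · filter_upwards [hformula, hbound] with n h1 h2
    have hb0 : 0 ≤ ∫ u, b u := integral_nonneg fun u =>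
      indicator_nonneg (fun s _ => by positivity) u
    refine (norm_le_iff_ev _ hb0).2 fun x => ?_
    rw [h1]
    exact norm_integral_le_of_norm_le hb (Eventually.of_forall (h2 x))
  · have hlim : ∫ u : ℝ, (Ioi (0 : ℝ)).indicator (fun u : ℝ => Complex.exp (-u) * ev x f) u =
        ev x f := by
      rw [integral_indicator measurableSet_Ioi, integral_mul_const]
      have := integral_exp_mul_complex_Ioi (a := -1) (by simp) 0
      simp only [neg_mul, one_mul] at this
      rw [this]
      simp
    have key : Tendsto (fun n : ℕ => ∫ u : ℝ, Complex.exp (-u) * ev x (causal T (u / n) f)) atTop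
        (𝓝 (∫ u : ℝ, (Ioi (0 : ℝ)).indicator (fun u : ℝ => Complex.exp (-u) * ev x f) u)) := by
      refine tendsto_integral_filter_of_dominated_convergence b (Eventually.of_forall fun n => ?_)
        (hbound.mono fun n h => Eventually.of_forall (h x)) hb (Eventually.of_forall fun u => ?_)
      · exact (Measurable.mul (by fun_prop) ((hexp.family.measurable f).comp
          (show Measurable fun u : ℝ => (u / (n : ℝ), x) by fun_prop))).aestronglyMeasurable
      · rcases le_or_gt u 0 with hu | hu
        · rw [indicator_of_notMem (by simpa using hu)]
          refine tendsto_const_nhds.congr fun n => ?_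
          rw [causal_of_nonpos T (div_nonpos_of_nonpos_of_nonneg hu n.cast_nonneg)]
          simp
        · rw [indicator_of_mem (mem_Ioi.2 hu)]
          have h0 : Tendsto (fun n : ℕ => u / (n : ℝ)) atTop (𝓝[>] 0) := by
            refine tendsto_nhdsWithin_iff.2 ⟨tendsto_const_div_atTop_nhds_zero_nat u, ?_⟩
            filter_upwards [hn] with n hn
            exact div_pos hu hn.1
          refine (((hT.tendsto_ev hf x).comp h0).congr' ?_).const_mul _
          filter_upwards [hn] with n hn
          rw [causal_of_pos T (div_pos hu hn.1)]
          rfl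
    rw [hlim] at key
    exact key.congr' (hformula.mono fun n h => (h x).symm)

end Semigroup

/-- Kernel operators agreeing on continuous functions are equal. -/
theorem IsKernelOperator.ext_of_continuous [MetricSpace M] [BorelSpace M]
    {A B : Bb M →L[ℂ] Bb M} (hA : IsKernelOperator A) (hB : IsKernelOperator B)
    (h : ∀ f, Continuous (fun x => ev x f) → A f = B f) : A = B := by
  have lim : ∀ (f : ℕ → Bb M) g, BPTendsto f atTop g → (∀ n, A (f n) = B (f n)) → A g = B g := by
    intro f g hfg hf
    refine ext_ev fun x => tendsto_nhds_unique (hA x f g hfg) ?_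
    simp only [hf]
    exact hB x f g hfg
  have basic : ∀ (c : ℂ) (F : Set M), IsClosed F → A (c • Bb.ind F) = B (c • Bb.ind F) := by
    intro c F hF
    have hle : ∀ n x, ‖((hF.apprSeq n x : ℝ) : ℂ)‖ ≤ 1 := fun n x => by
      rw [Complex.norm_real, Real.norm_of_nonneg NNReal.zero_le_coe]
      exact_mod_cast HasOuterApproxClosed.apprSeq_apply_le_one hF n x
    have hc : ∀ n, Continuous fun x => ((hF.apprSeq n x : ℝ) : ℂ) := fun n =>
      Complex.continuous_ofReal.comp (NNReal.continuous_coe.comp (hF.apprSeq n).continuous)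
    have h1 : A (Bb.ind F) = B (Bb.ind F) := by
      refine lim (fun n => Bb.mk _ (hc n).measurable (hle n)) _
        ⟨⟨1, Eventually.of_forall fun n => (norm_le_iff_ev _ zero_le_one).2 fun x => by
          simpa using hle n x⟩, fun x => ?_⟩ fun n => h _ (by simpa using hc n)
      simp only [ev_mk]
      have h2 := tendsto_pi_nhds.1 (HasOuterApproxClosed.tendsto_apprSeq hF) x
      have h3 := (Complex.continuous_ofReal.tendsto _).comp
        ((NNReal.continuous_coe.tendsto _).comp h2)
      have h4 : ev x (Bb.ind F) = (((F.indicator (fun _ => (1 : NNReal)) x : NNReal) : ℝ) : ℂ) := by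
        rw [ev_ind hF.measurableSet]
        by_cases hx : x ∈ F <;> simp [hx]
      rw [h4]
      exact h3
    rw [map_smul, map_smul, h1]
  refine ContinuousLinearMap.ext fun f => ?_
  exact bp_induction (p := fun f => A f = B f) (S := {F | IsClosed F})
    (BorelSpace.measurable_eq.trans borel_eq_generateFrom_isClosed) isPiSystem_isClosed
    (fun c => basic c univ isClosed_univ) basic
    (fun f g hf hg => by rw [map_add, map_add, hf, hg]) lim f

/-- Kernel operators agreeing on the range of the resolvent are equal. -/
theorem IsStrongFellerSemigroup.ext_of_laplace [MetricSpace M] [BorelSpace M]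
    {T : ℝ → Bb M →L[ℂ] Bb M} (hT : IsStrongFellerSemigroup T) {C ω : ℝ}
    (htype : IsOfType T C ω) {z : ℂ} (hz : ω < z.re) {A B : Bb M →L[ℂ] Bb M}
    (hA : IsKernelOperator A) (hB : IsKernelOperator B)
    (h : ∀ f, A (laplace (causal T) z f) = B (laplace (causal T) z f)) : A = B := by
  refine hA.ext_of_continuous hB fun f hf => ext_ev fun x => ?_
  have hbp := hT.bpTendsto_laplace htype hf
  refine tendsto_nhds_unique ((hA x _ _ hbp).congr' ?_) (hB x _ _ hbp)
  filter_upwards [tendsto_natCast_atTop_atTop.eventually (eventually_gt_atTop ω)] with n hn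
  have hn' : ω < ((n : ℂ)).re := by simpa using hn
  simp only [map_smul]
  rw [hT.laplace_eq_laplace htype hz hn', h]

end StrongFellerPerturbation

namespace StrongFellerPerturbation

section Extension

variable {M : Type*} [MeasurableSpace M]

theorem exists_sub_apply_eq {E : Type*} [NormedAddCommGroup E] [NormedSpace ℂ E] [CompleteSpace E]
    {A : E →L[ℂ] E} (hA : ‖A‖ < 1) (k : E) : ∃ h, h - A h = k := by
  obtain ⟨u, hu⟩ := isUnit_one_sub_of_norm_lt_one hA
  refine ⟨(↑u⁻¹ : E →L[ℂ] E) k, ?_⟩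
  have h1 : (u : E →L[ℂ] E) * (↑u⁻¹ : E →L[ℂ] E) = 1 := u.mul_inv
  rw [hu] at h1
  exact congrArg (fun L : E →L[ℂ] E => L k) h1

theorem IsExpBounded.laplace_eq_of_eq_add_conv {T P S : ℝ → Bb M →L[ℂ] Bb M} {c d ω : ℝ}
    {ψ : ℝ → ℝ} {z : ℂ} (hT : IsExpBounded T c ω) (hP : IsExpBounded P d ω)
    (hS : IsWeightIntegrable S ψ ω)
    (h : ∀ t, P t = T t + StrongFellerPerturbation.conv P S t) (hz : ω < z.re) (f : Bb M) :
    laplace P z f = laplace T z f + laplace P z (laplace S z f) := by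
  have hLT := hT.isLaplaceIntegrable hz
  have hLP := hP.isLaplaceIntegrable hz
  have hLS := hS.isLaplaceIntegrable hz.le
  have hLC := (hP.conv hS).isLaplaceIntegrable hz
  refine ext_ev fun x => ?_
  obtain ⟨a, ha⟩ := hLT.exists_isDominated f
  obtain ⟨b, hb⟩ := hLC.exists_isDominated f
  have hconv : ∫ t : ℝ, Complex.exp (-(z * t)) * ∫ s : ℝ, ev x (P (t - s) (S s f)) =
      ∫ t : ℝ, ev x (Complex.exp (-(z * t)) • StrongFellerPerturbation.conv P S t f) := by
    simp only [map_smul, smul_eq_mul, hP.ev_conv hS]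
  rw [map_add, hLP.ev_laplace_laplace hLS, hconv, hLP.ev_laplace', hLT.ev_laplace',
    ← integral_add (ha.integrable_ev x) (hb.integrable_ev x)]
  refine integral_congr_ae (Eventually.of_forall fun t => ?_)
  simp only [← map_add, ← smul_add]
  rw [h t]
  rfl

/-- The family `U` on `(0, ∞)`, extended by the identity. -/
def extendById (U : ℝ → Bb M →L[ℂ] Bb M) (t : ℝ) : Bb M →L[ℂ] Bb M :=
  if 0 < t then U t else ContinuousLinearMap.id ℂ (Bb M)

theorem extendById_of_pos (U : ℝ → Bb M →L[ℂ] Bb M) {t : ℝ} (ht : 0 < t) :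
    extendById U t = U t := if_pos ht

theorem extendById_of_nonpos (U : ℝ → Bb M →L[ℂ] Bb M) {t : ℝ} (ht : t ≤ 0) :
    extendById U t = ContinuousLinearMap.id ℂ (Bb M) := if_neg ht.not_gt

variable {P : ℝ → Bb M →L[ℂ] Bb M} {c ω' : ℝ}

theorem causal_extendById (hP : ∀ t ≤ 0, P t = 0) : causal (extendById P) = P := by
  ext1 t
  rcases le_or_gt t 0 with ht | ht
  · rw [causal_of_nonpos _ ht, hP t ht]
  · rw [causal_of_pos _ ht, extendById_of_pos P ht]

theorem IsExpBounded.isOfType_extendById (hP : IsExpBounded P c ω') (hc : 1 ≤ c) :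
    IsOfType (extendById P) c ω' := by
  refine ⟨hc, fun t ht => ?_⟩
  rcases ht.eq_or_lt with rfl | ht
  · rw [extendById_of_nonpos P le_rfl]
    simpa using ContinuousLinearMap.norm_id_le.trans hc
  · rw [extendById_of_pos P ht]
    exact hP.norm_le t

end Extension

section Perturbation

variable {M : Type*} [MetricSpace M] [MeasurableSpace M]
  {T : ℝ → Bb M →L[ℂ] Bb M} {C ω : ℝ} {B : Bb M →ₗ.[ℂ] Bb M} {BT : ℝ → Bb M →L[ℂ] Bb M}

/-- `K` is the bounded kernel operator `B R(z)`. -/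
structure IsResolventComp (T : ℝ → Bb M →L[ℂ] Bb M) (B : Bb M →ₗ.[ℂ] Bb M) (z : ℂ)
    (K : Bb M →L[ℂ] Bb M) : Prop where
  kernel : IsKernelOperator K
  mem_domain : ∀ f, laplace (causal T) z f ∈ B.domain
  apply_eq : ∀ f (h : laplace (causal T) z f ∈ B.domain), B ⟨laplace (causal T) z f, h⟩ = K f

/-- The kernel operators `BT t` extend `B T(t)` from the domain of the generator. -/
structure IsSemigroupComp (T : ℝ → Bb M →L[ℂ] Bb M) (B : Bb M →ₗ.[ℂ] Bb M)
    (BT : ℝ → Bb M →L[ℂ] Bb M) : Prop where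
  kernel : ∀ t, 0 < t → IsKernelOperator (BT t)
  apply_eq : ∀ t, 0 < t → ∀ f ∈ domain (fullGenerator T), ∀ h : T t f ∈ B.domain,
    B ⟨T t f, h⟩ = BT t f

variable {z w : ℂ} {K : Bb M →L[ℂ] Bb M}

theorem IsSemigroupComp.apply_laplace (hBT : IsSemigroupComp T B BT)
    (hT : IsStrongFellerSemigroup T) (htype : IsOfType T C ω) (hz : ω < z.re)
    (hK : IsResolventComp T B z K) {t : ℝ} (ht : 0 < t) (f : Bb M) :
    BT t (laplace (causal T) z f) = K (T t f) := by
  have hcomm := hT.laplace_comm htype hz ht.le f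
  have hmem : T t (laplace (causal T) z f) ∈ B.domain := by
    rw [hcomm]
    exact hK.mem_domain _
  rw [← hBT.apply_eq t ht _ (hT.laplace_mem_domain htype hz f) hmem,
    ← hK.apply_eq (T t f) (hK.mem_domain _)]
  congr 1
  exact Subtype.ext hcomm

theorem IsSemigroupComp.map_add [BorelSpace M] (hBT : IsSemigroupComp T B BT)
    (hT : IsStrongFellerSemigroup T) (htype : IsOfType T C ω) (hz : ω < z.re)
    (hK : IsResolventComp T B z K) {t s : ℝ} (ht : 0 < t) (hs : 0 < s) :
    BT (t + s) = (BT t).comp (T s) := by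
  refine hT.ext_of_laplace htype hz (hBT.kernel _ (add_pos ht hs))
    ((hBT.kernel t ht).comp (hT.kernel hs.le)) fun f => ?_
  rw [hBT.apply_laplace hT htype hz hK (add_pos ht hs), ContinuousLinearMap.comp_apply,
    hT.laplace_comm htype hz hs.le, hBT.apply_laplace hT htype hz hK ht,
    hT.map_add s t hs.le ht.le]
  rfl

theorem IsSemigroupComp.isKernelFamily [BorelSpace M] (hBT : IsSemigroupComp T B BT)
    (hT : IsStrongFellerSemigroup T) (htype : IsOfType T C ω) (hz : ω < z.re)
    (hK : IsResolventComp T B z K) : IsKernelFamily (causal BT) := by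
  refine IsKernelFamily.of_tendsto_right hBT.kernel fun t ht f x => ?_
  have ht2 : 0 < t / 2 := half_pos ht
  have hsplit : ∀ h, 0 ≤ h → BT (h + t) f = BT (t / 2) (T (h + t / 2) f) := fun h hh => by
    rw [show h + t = t / 2 + (h + t / 2) by ring,
      hBT.map_add hT htype hz hK ht2 (by positivity)]
    rfl
  have h0 := hsplit 0 le_rfl
  rw [zero_add, zero_add] at h0
  rw [h0]
  have hbp : BPTendsto (fun h => T (h + t / 2) f) (𝓝[>] 0) (T (t / 2) f) := by
    refine htype.bpTendsto (b := 1 + t / 2) ?_ (hT.tendsto_ev_right ht2 f)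
    filter_upwards [Ioo_mem_nhdsGT (zero_lt_one (α := ℝ))] with h hh
    exact ⟨by linarith [hh.1], by linarith [hh.2]⟩
  refine ((hBT.kernel _ ht2 x).tendsto hbp).congr' ?_
  filter_upwards [self_mem_nhdsWithin] with h hh
  rw [hsplit h (le_of_lt hh)]

theorem IsSemigroupComp.exists_isWeightIntegrable [BorelSpace M] (hBT : IsSemigroupComp T B BT)
    (hT : IsStrongFellerSemigroup T) (htype : IsOfType T C ω) (hz : ω < z.re)
    (hK : IsResolventComp T B z K) {φ : ℝ → ℝ} (hφ : LocallyIntegrableOn φ (Ici 0) volume)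
    (hbound : ∀ s, 0 < s → ‖BT s‖ ≤ φ s) :
    ∃ (ψ : ℝ → ℝ) (ω' : ℝ), ω < ω' ∧ IsWeightIntegrable (causal BT) ψ ω' ∧
      ∫ s, Real.exp (-(ω' * s)) * ψ s < 1 := by
  have hφ1 : 0 ≤ φ 1 := (norm_nonneg _).trans (hbound 1 one_pos)
  have hC := htype.nonneg
  let ψ : ℝ → ℝ := fun s => (Ioc 0 1).indicator φ s +
    (Ioi 1).indicator (fun s => φ 1 * C * Real.exp (|ω| * s)) s
  have hψ_zero : ∀ s ≤ 0, ψ s = 0 := fun s hs => by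
    have h1 : s ∉ Ioc (0 : ℝ) 1 := fun h => hs.not_gt h.1
    have h2 : s ∉ Ioi (1 : ℝ) := fun h => by
      have : (1 : ℝ) < s := h
      linarith
    simp only [ψ, indicator_of_notMem h1, indicator_of_notMem h2, add_zero]
  have hψ_le : ∀ s, ‖causal BT s‖ ≤ ψ s := fun s => by
    rcases le_or_gt s 0 with h0 | h0
    · rw [causal_of_nonpos BT h0, hψ_zero s h0, norm_zero]
    rw [causal_of_pos BT h0]
    rcases le_or_gt s 1 with h1 | h1
    · simp only [ψ, indicator_of_mem (show s ∈ Ioc (0 : ℝ) 1 from ⟨h0, h1⟩),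
        indicator_of_notMem (show s ∉ Ioi (1 : ℝ) from not_lt.2 h1), add_zero]
      exact hbound s h0
    · simp only [ψ, indicator_of_notMem (show s ∉ Ioc (0 : ℝ) 1 from fun h => h1.not_ge h.2),
        indicator_of_mem (mem_Ioi.2 h1), zero_add]
      have h2 : BT s = (BT 1).comp (T (s - 1)) := by
        rw [← hBT.map_add hT htype hz hK one_pos (sub_pos.2 h1)]
        congr 1
        ring
      rw [h2, mul_assoc]
      refine (ContinuousLinearMap.opNorm_comp_le _ _).trans
        (mul_le_mul (hbound 1 one_pos) ((htype.2 _ (sub_pos.2 h1).le).trans ?_)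
          (norm_nonneg _) hφ1)
      refine mul_le_mul_of_nonneg_left (Real.exp_le_exp.2 ?_) hC
      nlinarith [le_abs_self ω, abs_nonneg ω]
  have hψ_nonneg : ∀ s, 0 ≤ ψ s := fun s => (norm_nonneg _).trans (hψ_le s)
  have hint : Integrable (fun s => Real.exp (-((|ω| + 1) * s)) * ψ s) := by
    have h1 : IntegrableOn φ (Icc 0 1) :=
      hφ.integrableOn_compact_subset Icc_subset_Ici_self isCompact_Icc
    have h2 : IntegrableOn (fun s => Real.exp (-((|ω| + 1) * s)) * φ s) (Icc 0 1) :=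
      h1.continuousOn_mul (by fun_prop) isCompact_Icc
    have h3 : IntegrableOn (fun s => φ 1 * C * Real.exp (-1 * s)) (Ioi 1) :=
      (exp_neg_integrableOn_Ioi 1 one_pos).const_mul _
    refine (((h2.mono_set Ioc_subset_Icc_self).integrable_indicator measurableSet_Ioc).add
      (h3.integrable_indicator measurableSet_Ioi)).congr (Eventually.of_forall fun s => ?_)
    simp only [ψ, Pi.add_apply, mul_add, indicator]
    congr 1
    · split_ifs <;> simp
    · split_ifs
      · rw [mul_left_comm, ← Real.exp_add]
        congr 2
        ring
      · simp
  have hmono : ∀ (n : ℕ) s, ‖Real.exp (-((|ω| + 1 + n) * s)) * ψ s‖ ≤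
      Real.exp (-((|ω| + 1) * s)) * ψ s := fun n s => by
    rw [Real.norm_of_nonneg (mul_nonneg (Real.exp_nonneg _) (hψ_nonneg s))]
    rcases le_or_gt s 0 with h0 | h0
    · simp [hψ_zero s h0]
    · refine mul_le_mul_of_nonneg_right (Real.exp_le_exp.2 ?_) (hψ_nonneg s)
      have : 0 ≤ (n : ℝ) * s := by positivity
      linarith
  have hmeas : ∀ n : ℕ, AEStronglyMeasurable (fun s => Real.exp (-((|ω| + 1 + n) * s)) * ψ s)
      volume := fun n => by
    have : (fun s => Real.exp (-((|ω| + 1 + n) * s)) * ψ s) =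
        fun s => Real.exp (-(n * s)) * (Real.exp (-((|ω| + 1) * s)) * ψ s) := by
      ext s
      rw [← mul_assoc, ← Real.exp_add]
      congr 2
      ring
    rw [this]
    exact AEStronglyMeasurable.mul (by fun_prop) hint.aestronglyMeasurable
  have hlim : Tendsto (fun n : ℕ => ∫ s, Real.exp (-((|ω| + 1 + n) * s)) * ψ s) atTop
      (𝓝 (∫ _ : ℝ, (0 : ℝ))) := by
    refine tendsto_integral_of_dominated_convergence _ hmeas hint
      (fun n => Eventually.of_forall (hmono n)) (Eventually.of_forall fun s => ?_)
    rcases le_or_gt s 0 with h0 | h0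
    · simp [hψ_zero s h0]
    · have h1 : Tendsto (fun n : ℕ => (|ω| + 1 + (n : ℝ)) * s) atTop atTop :=
        (tendsto_atTop_add_const_left _ _ tendsto_natCast_atTop_atTop).atTop_mul_const h0
      simpa using (Real.tendsto_exp_neg_atTop_nhds_zero.comp h1).mul_const (ψ s)
  rw [integral_zero] at hlim
  obtain ⟨n, hn⟩ := (hlim.eventually (gt_mem_nhds one_pos)).exists
  refine ⟨ψ, |ω| + 1 + n, ?_, ⟨hBT.isKernelFamily hT htype hz hK,
    fun s hs => causal_of_nonpos BT hs, hψ_le, hint.mono' (hmeas n)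
      (Eventually.of_forall (hmono n))⟩, hn⟩
  have := le_abs_self ω
  have : (0 : ℝ) ≤ n := n.cast_nonneg
  linarith

/-- The Laplace transform of `B T(·)` is `B R(·)`. -/
theorem IsSemigroupComp.isResolventComp_laplace [BorelSpace M] (hBT : IsSemigroupComp T B BT)
    (hT : IsStrongFellerSemigroup T) (htype : IsOfType T C ω) (hz : ω < z.re)
    (hK : IsResolventComp T B z K) (hw : ω < w.re) (hL : IsLaplaceIntegrable (causal BT) w) :
    IsResolventComp T B w (laplace (causal BT) w) := by
  have hmem : ∀ f, laplace (causal T) w f ∈ B.domain := fun f => by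
    rw [hT.laplace_eq_laplace htype hz hw]
    exact hK.mem_domain _
  have hLw := hT.isLaplaceIntegrable htype hw
  let N : Bb M →L[ℂ] Bb M :=
    K.comp (ContinuousLinearMap.id ℂ (Bb M) + (z - w) • laplace (causal T) w)
  have hN : ∀ f (h : laplace (causal T) w f ∈ B.domain), B ⟨laplace (causal T) w f, h⟩ = N f := by
    intro f h
    change _ = K (f + (z - w) • laplace (causal T) w f)
    rw [← hK.apply_eq _ (hK.mem_domain _)]
    congr 1
    exact Subtype.ext (hT.laplace_eq_laplace htype hz hw f)
  have hNL : N = laplace (causal BT) w := by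
    refine hT.ext_of_laplace htype hz
      (hK.kernel.comp (IsKernelOperator.id.add (hLw.isKernelOperator.smul _)))
      hL.isKernelOperator fun f => ?_
    have h1 : N (laplace (causal T) z f) = K (laplace (causal T) w f) := by
      rw [← hN _ (hmem _), ← hK.apply_eq _ (hK.mem_domain _)]
      congr 1
      exact Subtype.ext (hT.laplace_comp_comm htype hw hz f)
    rw [h1]
    refine ext_ev fun x => ?_
    rw [hLw.ev_comp_laplace hK.kernel, hL.ev_laplace]
    refine integral_congr_ae (Eventually.of_forall fun s => ?_)
    rcases le_or_gt s 0 with hs | hs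
    · simp [causal_of_nonpos _ hs]
    · simp only [causal_of_pos _ hs, hBT.apply_laplace hT htype hz hK hs]
  exact ⟨hL.isKernelOperator, hmem, fun f h => by rw [hN, hNL]⟩

variable {P : ℝ → Bb M →L[ℂ] Bb M} {c ω' : ℝ} {ψ : ℝ → ℝ}

theorem tendsto_ev_of_eq_add_conv (hT : IsStrongFellerSemigroup T)
    (hP : IsExpBounded P c ω') (hS : IsWeightIntegrable (causal BT) ψ ω')
    (h : ∀ t, P t = causal T t + conv P (causal BT) t) {f : Bb M}
    (hf : Continuous fun x => ev x f) (x : M) :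
    Tendsto (fun t => ev x (P t f)) (𝓝[>] 0) (𝓝 (ev x f)) := by
  have hconv : Tendsto (fun t => ev x (conv P (causal BT) t f)) (𝓝[>] 0)
      (𝓝 (∫ _ : ℝ, (0 : ℂ))) := by
    simp only [hP.ev_conv hS]
    refine tendsto_integral_filter_of_dominated_convergence
      (fun s => c * Real.exp (|ω'| * 1) * (Real.exp (-(ω' * s)) * ψ s) * ‖f‖)
      (Eventually.of_forall fun t =>
        ((hP.isDominated hS t f).integrable_ev x).aestronglyMeasurable) ?_
      (by
        have := (hS.integrable.const_mul (c * Real.exp (|ω'| * 1))).mul_const ‖f‖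
        exact this) (Eventually.of_forall fun s => ?_)
    · filter_upwards [Ioo_mem_nhdsGT (zero_lt_one (α := ℝ))] with t ht
      refine Eventually.of_forall fun s => (norm_ev_le _ x).trans
        (((hP.isDominated hS t f).norm_le s).trans ?_)
      have h1 : 0 ≤ ψ s := (norm_nonneg _).trans (hS.norm_le s)
      have h2 : ω' * t ≤ |ω'| * 1 :=
        mul_le_mul (le_abs_self ω') ht.2.le ht.1.le (abs_nonneg ω')
      have := hP.nonneg
      gcongr
    · refine tendsto_const_nhds.congr' ?_
      rcases le_or_gt s 0 with hs | hs
      · exact Eventually.of_forall fun t => by simp [hS.eq_zero s hs]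
      · filter_upwards [Ioo_mem_nhdsGT hs] with t ht
        simp [hP.eq_zero (t - s) (by linarith [ht.2])]
  rw [integral_zero] at hconv
  have := (hT.tendsto_ev hf x).add hconv
  rw [add_zero] at this
  refine this.congr' ?_
  filter_upwards [self_mem_nhdsWithin] with t ht
  rw [h t, _root_.add_apply, map_add, causal_of_pos T ht]

theorem IsExpBounded.isStrongFellerSemigroup_extendById (hP : IsExpBounded P c ω') (hc : 1 ≤ c)
    (hadd : ∀ t s, 0 < t → 0 < s → P (t + s) = (P t).comp (P s))
    (hcont : ∀ t f, Continuous fun x => ev x (P t f))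
    (hlim : ∀ f, Continuous (fun x => ev x f) → ∀ x,
      Tendsto (fun t => ev x (P t f)) (𝓝[>] 0) (𝓝 (ev x f))) :
    IsStrongFellerSemigroup (extendById P) where
  sigmaContinuous t _ := by
    rw [isSigmaContinuous_iff]
    rcases le_or_gt t 0 with ht | ht
    · rw [extendById_of_nonpos P ht]
      exact IsKernelOperator.id
    · rw [extendById_of_pos P ht]
      exact hP.family.kernel t
  map_zero := extendById_of_nonpos P le_rfl
  map_add s t hs ht := by
    rcases hs.eq_or_lt with rfl | hs
    · rw [add_zero, extendById_of_nonpos P le_rfl, ContinuousLinearMap.comp_id]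
    rcases ht.eq_or_lt with rfl | ht
    · rw [zero_add, extendById_of_nonpos P le_rfl, ContinuousLinearMap.id_comp]
    rw [extendById_of_pos P hs, extendById_of_pos P ht, extendById_of_pos P (add_pos ht hs),
      hadd t s ht hs]
  strongFeller t ht f := by
    rw [extendById_of_pos P ht]
    exact hcont t f
  tendsto_zero f hf := by
    refine bpTendsto_sigma ((hP.isOfType_extendById hc).bpTendsto (b := 1) ?_ fun x =>
      (hlim f hf x).congr' ?_)
    · filter_upwards [Ioo_mem_nhdsGT (zero_lt_one (α := ℝ))] with t ht using ⟨ht.1.le, ht.2.le⟩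
    · filter_upwards [self_mem_nhdsWithin] with t ht
      rw [extendById_of_pos P ht]

omit [MetricSpace M] in
/-- The variation of constants formula as a weak integral. -/
theorem IsExpBounded.hasWeakIntegral_extendById (hT : T 0 = ContinuousLinearMap.id ℂ (Bb M))
    (hP : IsExpBounded P c ω') (hS : IsWeightIntegrable (causal BT) ψ ω')
    (h : ∀ t, P t = causal T t + StrongFellerPerturbation.conv P (causal BT) t) {t : ℝ}
    (ht : 0 ≤ t) (f : Bb M) :
    HasWeakIntegral (volume.restrict (Ioc 0 t)) (fun s => extendById P (t - s) (BT s f))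
      (extendById P t f - T t f) := by
  have hdom := hP.isDominated hS t f
  have hdiff : extendById P t f - T t f =
      StrongFellerPerturbation.conv P (causal BT) t f := by
    rcases ht.eq_or_lt with rfl | ht
    · rw [(hP.conv hS).eq_zero 0 le_rfl, extendById_of_nonpos P le_rfl, hT]
      simp
    · rw [extendById_of_pos P ht, h t, causal_of_pos T ht, _root_.add_apply, add_sub_cancel_left]
  rw [hdiff]
  refine ((hdom.restrict (Ioc 0 t)).hasWeakIntegral fun x => ?_).congr_ae ?_
  · rw [hP.ev_conv hS]
    refine (setIntegral_eq_integral_of_forall_compl_eq_zero fun s hs => ?_).symm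
    rcases le_or_gt s 0 with h0 | h0
    · simp [hS.eq_zero s h0]
    · have : t - s ≤ 0 := by
        by_contra! h1
        exact hs ⟨h0, by linarith⟩
      simp [hP.eq_zero _ this]
  · have hne : ∀ᵐ s ∂(volume.restrict (Ioc 0 t)), s ≠ t :=
      ae_restrict_of_ae (by simp [ae_iff])
    filter_upwards [self_mem_ae_restrict measurableSet_Ioc, hne] with s hs hst
    rw [causal_of_pos BT hs.1, extendById_of_pos P (sub_pos.2 (lt_of_le_of_ne hs.2 hst))]

/-- The generator of a semigroup whose resolvent satisfies `R_P = R_T + R_P B R_T`. -/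
theorem fullGenerator_eq_addOperator (hT : IsStrongFellerSemigroup T) (htype : IsOfType T C ω)
    (hP : IsStrongFellerSemigroup P) (hPtype : IsOfType P c ω') (hω : ω ≤ ω')
    {A : ℂ → Bb M →L[ℂ] Bb M} (hA : ∀ z : ℂ, ω' < z.re → IsResolventComp T B z (A z))
    (hA_norm : ∀ z : ℂ, ω' < z.re → ‖A z‖ < 1)
    (hres : ∀ z : ℂ, ω' < z.re → ∀ f, laplace (causal P) z f =
      laplace (causal T) z f + laplace (causal P) z (A z f)) :
    fullGenerator P = addOperator (fullGenerator T) B := by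
  ext ⟨f, g⟩
  rw [hP.mem_fullGenerator_iff hPtype]
  constructor
  · rintro ⟨z, hz, hfg⟩
    obtain ⟨h, hh⟩ := exists_sub_apply_eq (hA_norm z hz) (z • f - g)
    have hf : laplace (causal T) z h = f := by
      rw [← hh, map_sub, hres z hz h] at hfg
      simpa using hfg
    have hmem : f ∈ B.domain := hf ▸ (hA z hz).mem_domain h
    refine ⟨z • f - h, (hT.mem_fullGenerator_iff htype).2 ⟨z, hω.trans_lt hz, by simpa using hf⟩,
      hmem, ?_⟩
    have hB : B ⟨f, hmem⟩ = A z h := by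
      rw [← (hA z hz).apply_eq h ((hA z hz).mem_domain h)]
      congr 1
      exact Subtype.ext hf.symm
    change g = z • f - h + B ⟨f, hmem⟩
    rw [hB, ← sub_eq_zero, ← sub_eq_zero.2 hh]
    abel
  · rintro ⟨g', hfg', hmem, hg⟩
    change g = g' + B ⟨f, hmem⟩ at hg
    obtain ⟨z₀, hz₀, hz₀'⟩ := (hT.mem_fullGenerator_iff htype).1 hfg'
    obtain ⟨r, hr⟩ := exists_gt ω'
    have hr' : ω' < ((r : ℂ)).re := hr
    have hf := hT.laplace_smul_sub htype hz₀ (hω.trans_lt hr') hz₀'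
    refine ⟨r, hr', ?_⟩
    have hB : B ⟨f, hmem⟩ = A r ((r : ℂ) • f - g') := by
      rw [← (hA r hr').apply_eq _ ((hA r hr').mem_domain _)]
      congr 1
      exact Subtype.ext hf.symm
    rw [hg, hB, ← sub_sub, map_sub, hres r hr' ((r : ℂ) • f - g'), hf]
    simp

end Perturbation

end StrongFellerPerturbation

end

theorem theorem3p3 {M : Type*} [MetricSpace M] [CompleteSpace M] [TopologicalSpace.SeparableSpace M]
    [MeasurableSpace M] [BorelSpace M]
    -- a strong Feller semigroup of type `(C, ω)`
    (T : ℝ → (Bb M →L[ℂ] Bb M)) (hT : IsStrongFellerSemigroup T)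
    (C ω : ℝ) (htype : IsOfType T C ω)
    -- a linear operator `B : D(B) → B_b(M)` with `D(𝓛) ⊆ D(B)`
    (B : Bb M →ₗ.[ℂ] Bb M)
    (hdom : domain (fullGenerator T) ⊆ (B.domain : Set (Bb M)))
    -- `B 𝓡(z)` is `σ`-continuous for one `z` with `Re z > ω`
    (hBR : ∃ z : ℂ, ω < z.re ∧ ∃ K : Bb M →L[ℂ] Bb M, IsSigmaContinuous K ∧
      ∀ f u : Bb M, IsLaplaceTransform T z f u → ∀ hu : u ∈ B.domain, B ⟨u, hu⟩ = K f)
    -- `BT t` is the `σ`-continuous extension of `B T(t)`, initially defined on `D(𝓛)`, for `t > 0`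
    (BT : ℝ → (Bb M →L[ℂ] Bb M))
    (hBT : ∀ t, 0 < t → IsSigmaContinuous (BT t))
    (hBT_eq : ∀ t, 0 < t → ∀ f ∈ domain (fullGenerator T), ∀ h : T t f ∈ B.domain,
      B ⟨T t f, h⟩ = BT t f)
    -- scalar measurability on `(0, ∞)`
    (hmeas : ∀ (f : Bb M) (μ : ComplexMeasure M),
      Measurable (fun s : Ioi (0 : ℝ) => dual (BT s f) μ))
    -- the bound by a function in `L¹_loc([0, ∞))`
    (φ : ℝ → ℝ) (hφ : LocallyIntegrableOn φ (Ici 0) volume)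
    (hbound : ∀ s, 0 < s → ‖BT s‖ ≤ φ s) :
    ∃ P : ℝ → (Bb M →L[ℂ] Bb M), IsStrongFellerSemigroup P ∧
      fullGenerator P = addOperator (fullGenerator T) B ∧
      ∀ (t : ℝ), 0 ≤ t → ∀ f : Bb M,
        HasWeakIntegral (volume.restrict (Ioc 0 t)) (fun s => P (t - s) (BT s f))
          (P t f - T t f) := by
  obtain ⟨z, hz, K, hK, hBK⟩ := hBR
  have hKz : IsResolventComp T B z K :=
    ⟨isSigmaContinuous_iff.1 hK, fun f => hdom (hT.laplace_mem_domain htype hz f),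
      fun f h => hBK f _ ((hT.isLaplaceTransform_iff htype hz).2 rfl) h⟩
  have hBTz : IsSemigroupComp T B BT :=
    ⟨fun t ht => isSigmaContinuous_iff.1 (hBT t ht), hBT_eq⟩
  obtain ⟨ψ, ω', hω, hS, hq⟩ :=
    hBTz.exists_isWeightIntegrable hT htype hz hKz hφ hbound
  have hTexp : IsExpBounded (causal T) C ω' := (hT.isExpBounded htype).mono le_rfl hω.le
  have hTcont : ∀ t f, Continuous fun x => ev x (causal T t f) := fun t f => by
    rcases le_or_gt t 0 with ht | ht
    · simpa [causal_of_nonpos T ht] using continuous_const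
    · rw [causal_of_pos T ht]
      exact hT.continuous_ev ht f
  obtain ⟨P, hP, hPeq, hPcont⟩ := hTexp.exists_eq_add_conv hS hq hTcont
  have hc : 1 ≤ C / (1 - ∫ s, Real.exp (-(ω' * s)) * ψ s) := by
    rw [le_div_iff₀ (sub_pos.2 hq)]
    linarith [hS.integral_nonneg, htype.1]
  have hadd : ∀ t s, 0 < t → 0 < s → P (t + s) = (P t).comp (P s) := fun t s ht hs => by
    refine hS.semigroup_of_eq_add_conv hq hP hPeq (fun t s ht hs => ?_) (fun t s ht hs => ?_) ht hs
    · rw [causal_of_pos T ht, causal_of_pos T hs, causal_of_pos T (add_pos ht hs)]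
      exact hT.map_add s t hs.le ht.le
    · rw [causal_of_pos BT ht, causal_of_pos T hs, causal_of_pos BT (add_pos ht hs)]
      exact hBTz.map_add hT htype hz hKz ht hs
  have hsg := hP.isStrongFellerSemigroup_extendById hc hadd hPcont
    (fun f hf => tendsto_ev_of_eq_add_conv hT hP hS hPeq hf)
  refine ⟨extendById P, hsg, ?_, fun t ht f =>
    hP.hasWeakIntegral_extendById hT.map_zero hS hPeq ht f⟩
  refine fullGenerator_eq_addOperator hT htype hsg (hP.isOfType_extendById hc) hω.le
    (fun w hw => hBTz.isResolventComp_laplace hT htype hz hKz (hω.trans hw)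
      (hS.isLaplaceIntegrable hw.le))
    (fun w hw => (hS.norm_laplace_le hw.le).trans_lt hq) fun w hw f => ?_
  rw [causal_extendById hP.eq_zero]
  exact hTexp.laplace_eq_of_eq_add_conv hP hS hPeq hw f
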